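/- Let $X$ be a complex Banach space with dual $X^*$, let $1\le p\le\infty$, and let $p^*$ be the conjugate exponent, $1/p+1/p^*=1$ (with $1/\infty=0$). Let $\mathbb T^{\mathbb N}$ carry its normalized Haar measure $d\omega$, write $\omega^\alpha=\prod_i\omega_i^{\alpha_i}$ for finitely supported $\alpha\in\mathbb Z^{(\mathbb N)}$, and write $\mathfrak p^\alpha=\prod_i\mathfrak p_i^{\alpha_i}$ for $\alpha\in\mathbb N_0^{(\mathbb N)}$, where $\mathfrak p_1<\mathfrak p_2<\dots$ are the primes. Put $E_p(\mathbb T^{\mathbb N},X)=L_p(\mathbb T^{\mathbb N},X)$ (Bochner) if $p<\infty$ and $E_\infty(\mathbb T^{\mathbb N},X)=C(\mathbb T^{\mathbb N},X)$, and let $E_p(\mathbb T^{\mathbb N},X)^*_+$ be the subspace of all $f\in E_p(\mathbb T^{\mathbb N},X)^*$ with $f(\omega^{-\alpha}\otimes x)=0$ for all $x\in X$ and all $\alpha\in\mathbb Z^{(\mathbb N)}\setminus\mathbb N_0^{(\mathbb N)}$. For a complex Banach space $Y$ and $1\le r\le\infty$, let $H_r(\mathbb T^{\mathbb N},Y)$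 be the space of all $g\in L_r(\mathbb T^{\mathbb N},Y)$ whose Fourier coefficients $\hat g(\alpha)=\int g(\omega)\,\omega^{-\alpha}\,d\omega$ vanish for $\alpha\in\mathbb Z^{(\mathbb N)}\setminus\mathbb N_0^{(\mathbb N)}$. Let $\mathcal H_r(Y)$ be its isometric image under the Bohr transform, i.e. the space of formal Dirichlet series $\sum_n a_n n^{-s}$ with $a_{\mathfrak p^\alpha}=\hat g(\alpha)$ for all $\alpha\in\mathbb N_0^{(\mathbb N)}$ for some $g\in H_r(\mathbb T^{\mathbb N},Y)$, with norm $\|g\|_{L_r}$. Let $\mathcal H_r^+(Y)$ be the space of all formal Dirichlet series $D=\sum_n a_nn^{-s}$ in $Y$ such that $D_\varepsilon=\sum_n \frac{a_n}{n^\varepsilon}n^{-s}\in\mathcal H_r(Y)$ for every $\varepsilon>0$ and $\|D\|_{\mathcal H^+_r(Y)}:=\sup_{\varepsilon>0}\|D_\varepsilon\|_{\mathcal H_r(Y)}<\infty$. Then for every $1\le p\le\infty$ there is an isometric linear isomorphism of $E_p(\mathbb T^{\mathbb N},X)^*_+$ onto $\mathcal H^+_{p^*}(X^*)$ which associates to each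 functional $f$ the Dirichlet series $\sum_n a_n^*n^{-s}$ whose coefficients $a_n^*\in X^*$ satisfy $$a^*_{\mathfrak p^\alpha}(x)=f(\omega^{-\alpha}\otimes x)\qquad\text{for all }\alpha\in\mathbb N_0^{(\mathbb N)},\ x\in X.$$ -/

import Mathlib

open scoped ENNReal

namespace BohrHardy

open MeasureTheory

/-! ### The infinite torus, its Haar measure, monomials -/

/-- The Borel `σ`-algebra of the unit circle. -/
noncomputable instance instMeasurableSpaceCircle : MeasurableSpace Circle := borel Circle

instance instBorelSpaceCircle : BorelSpace Circle := ⟨rfl⟩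

/-- The infinite dimensional torus `𝕋^ℕ`. -/
abbrev Torus : Type := ℕ → Circle

/-- The normalized Haar measure of `𝕋^ℕ`. -/
noncomputable def haar : Measure Torus := Measure.haarMeasure ⊤

instance instIsProbabilityMeasureHaar : IsProbabilityMeasure haar :=
  ⟨by simpa [haar] using
    Measure.haarMeasure_self (K₀ := (⊤ : TopologicalSpace.PositiveCompacts Torus))⟩

instance instIsHaarMeasureHaar : haar.IsHaarMeasure := by
  unfold haar; infer_instance

/-- The monomial `ω ↦ ω^α` for a finitely supported integer sequence `α`. -/
noncomputable def mono (α : ℕ →₀ ℤ) : C(Torus, ℂ) where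
  toFun ω := ((α.prod fun i k => ω i ^ k : Circle) : ℂ)
  continuous_toFun := by
    have h : Continuous fun ω : Torus => (α.prod fun i k => ω i ^ k : Circle) := by
      unfold Finsupp.prod
      exact continuous_finsetProd _ fun i _ => (continuous_apply i).zpow _
    exact continuous_subtype_val.comp h

theorem mono_add (α β : ℕ →₀ ℤ) : mono (α + β) = mono α * mono β := by
  ext ω
  simp only [mono, ContinuousMap.coe_mk, ContinuousMap.mul_apply, ← Circle.coe_mul]
  rw [Finsupp.prod_add_index' (fun i => zpow_zero _) (fun i m n => zpow_add _ _ _)]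

theorem mono_zero : mono 0 = 1 := by
  ext ω; simp [mono]

theorem mono_neg (α : ℕ →₀ ℤ) : mono (-α) = star (mono α) := by
  ext ω
  have h : ((-α).prod fun i k => ω i ^ k : Circle) = (α.prod fun i k => ω i ^ k)⁻¹ := by
    rw [Finsupp.prod_neg_index (fun i => zpow_zero _)]
    simp [Finsupp.prod, zpow_neg]
  simp only [mono, ContinuousMap.coe_mk, ContinuousMap.star_apply, h, Circle.coe_inv_eq_conj]
  rfl

theorem norm_mono (α : ℕ →₀ ℤ) (ω : Torus) : ‖mono α ω‖ = 1 := by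
  exact Circle.norm_coe _

/-- The `*`-algebra of trigonometric polynomials on `𝕋^ℕ`. -/
noncomputable def trigPoly : StarSubalgebra ℂ C(Torus, ℂ) where
  toSubalgebra := Algebra.adjoin ℂ (Set.range mono)
  star_mem' := by
    change Algebra.adjoin ℂ (Set.range mono) ≤ star (Algebra.adjoin ℂ (Set.range mono))
    refine Algebra.adjoin_le ?_
    rintro - ⟨α, rfl⟩
    exact Algebra.subset_adjoin ⟨-α, mono_neg α⟩

theorem trigPoly_coe :
    Subalgebra.toSubmodule trigPoly.toSubalgebra = Submodule.span ℂ (Set.range mono) := by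
  apply Algebra.adjoin_eq_span_of_subset
  refine Set.Subset.trans ?_ Submodule.subset_span
  intro x hx
  refine Submonoid.closure_induction (fun _ => id) ⟨0, mono_zero⟩ ?_ hx
  rintro - - - - ⟨m, rfl⟩ ⟨n, rfl⟩
  exact ⟨m + n, mono_add m n⟩

theorem span_mono_closure : (Submodule.span ℂ (Set.range mono)).topologicalClosure = ⊤ := by
  have hsep : trigPoly.SeparatesPoints := by
    intro x y hxy
    obtain ⟨i, hi⟩ := Function.ne_iff.mp hxy
    refine ⟨_, ⟨mono (Finsupp.single i 1), Algebra.subset_adjoin ⟨_, rfl⟩, rfl⟩, ?_⟩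
    simpa [mono, Circle.ext_iff] using hi
  rw [← trigPoly_coe]
  exact congr_arg (Subalgebra.toSubmodule <| StarSubalgebra.toSubalgebra ·)
    (ContinuousMap.starSubalgebra_topologicalClosure_eq_top_of_separatesPoints trigPoly hsep)

/-! ### Fourier coefficients -/

section

variable {X : Type*} [NormedAddCommGroup X] [NormedSpace ℂ X]

/-- The Fourier coefficient `∫ f(ω) ω^{-α} dω`. -/
noncomputable def fourierCoeff (f : Torus → X) (α : ℕ →₀ ℤ) : X :=
  ∫ ω, mono (-α) ω • f ω ∂haar

theorem integrable_smul {f : Torus → X} (hf : Integrable f haar) (g : C(Torus, ℂ)) :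
    Integrable (fun ω => g ω • f ω) haar :=
  hf.bdd_smul ‖g‖ g.continuous.aestronglyMeasurable (.of_forall g.norm_coe_le_norm)

theorem integrable_Lp {p : ℝ≥0∞} [hp : Fact (1 ≤ p)] (f : Lp X p haar) : Integrable f haar :=
  (Lp.memLp f).integrable hp.out

theorem fourierCoeff_add {p : ℝ≥0∞} [Fact (1 ≤ p)] (f g : Lp X p haar) (α : ℕ →₀ ℤ) :
    fourierCoeff (f + g : Lp X p haar) α = fourierCoeff f α + fourierCoeff g α := by
  unfold fourierCoeff
  rw [← integral_add (integrable_smul (integrable_Lp f) _) (integrable_smul (integrable_Lp g) _)]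
  refine integral_congr_ae ?_
  filter_upwards [Lp.coeFn_add f g] with ω h
  rw [h, Pi.add_apply, smul_add]

theorem fourierCoeff_smul {p : ℝ≥0∞} [Fact (1 ≤ p)] (c : ℂ) (f : Lp X p haar) (α : ℕ →₀ ℤ) :
    fourierCoeff (c • f : Lp X p haar) α = c • fourierCoeff f α := by
  unfold fourierCoeff
  rw [← integral_smul]
  refine integral_congr_ae ?_
  filter_upwards [Lp.coeFn_smul c f] with ω h
  rw [h, Pi.smul_apply, smul_comm]

/-- An integrable function on `𝕋^ℕ` is determined by its Fourier coefficients. -/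
theorem ae_eq_zero_of_fourierCoeff [CompleteSpace X] {f : Torus → X} (hf : Integrable f haar)
    (h : ∀ α, fourierCoeff f α = 0) : f =ᵐ[haar] 0 := by
  let L : C(Torus, ℂ) →L[ℂ] X := LinearMap.mkContinuous
    { toFun := fun g => ∫ ω, g ω • f ω ∂haar
      map_add' := fun g k => by
        simp only [ContinuousMap.add_apply, add_smul]
        exact integral_add (integrable_smul hf g) (integrable_smul hf k)
      map_smul' := fun c g => by
        simp only [ContinuousMap.smul_apply, smul_assoc, RingHom.id_apply]
        exact integral_smul c _ } (∫ ω, ‖f ω‖ ∂haar) (fun g => by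
      rw [mul_comm, ← integral_const_mul]
      refine norm_integral_le_of_norm_le (hf.norm.const_mul _) (.of_forall fun ω => ?_)
      rw [norm_smul]
      exact mul_le_mul_of_nonneg_right (g.norm_coe_le_norm ω) (norm_nonneg _))
  have hL : ∀ g, L g = 0 := by
    intro g
    have hg : g ∈ (Submodule.span ℂ (Set.range mono)).topologicalClosure := by
      rw [span_mono_closure]; trivial
    have hle : (Submodule.span ℂ (Set.range mono)).topologicalClosure ≤ L.ker := by
      refine Submodule.topologicalClosure_minimal _ (Submodule.span_le.mpr ?_) L.isClosed_ker
      rintro - ⟨α, rfl⟩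
      have := h (-α)
      rw [fourierCoeff, neg_neg] at this
      exact this
    exact hle hg
  refine ae_eq_zero_of_forall_setIntegral_isClosed_eq_zero hf fun s hs => ?_
  have hlim : Filter.Tendsto
      (fun n => ∫ ω, (((hs.apprSeq n ω : NNReal) : ℝ) : ℂ) • f ω ∂haar) Filter.atTop
      (nhds (∫ ω, s.indicator f ω ∂haar)) := by
    refine tendsto_integral_of_dominated_convergence (fun ω => ‖f ω‖) (fun n => ?_) hf.norm
      (fun n => .of_forall fun ω => ?_) (.of_forall fun ω => ?_)
    · refine AEStronglyMeasurable.smul (Continuous.aestronglyMeasurable ?_) hf.1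
      have := (hs.apprSeq n).continuous
      fun_prop
    · rw [norm_smul]
      refine mul_le_of_le_one_left (norm_nonneg _) ?_
      simpa using HasOuterApproxClosed.apprSeq_apply_le_one hs n ω
    · have h1 := tendsto_pi_nhds.mp (HasOuterApproxClosed.tendsto_apprSeq hs) ω
      have h2 : Filter.Tendsto (fun n => (((hs.apprSeq n ω : NNReal) : ℝ) : ℂ)) Filter.atTop
          (nhds (((s.indicator (fun _ => (1 : NNReal)) ω : NNReal) : ℝ) : ℂ)) :=
        ((Complex.continuous_ofReal.comp NNReal.continuous_coe).tendsto _).comp h1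
      have h3 := h2.smul_const (f ω)
      by_cases hω : ω ∈ s
      · simpa [hω] using h3
      · simpa [hω] using h3
  rw [← integral_indicator hs.measurableSet]
  refine tendsto_nhds_unique hlim ?_
  have : ∀ n, ∫ ω, (((hs.apprSeq n ω : NNReal) : ℝ) : ℂ) • f ω ∂haar = 0 := fun n =>
    hL ⟨fun ω => (((hs.apprSeq n ω : NNReal) : ℝ) : ℂ), by
      have := (hs.apprSeq n).continuous
      fun_prop⟩
  simp only [this]
  exact tendsto_const_nhds

end

/-! ### Dirichlet series and the Bohr transform -/

/-- Formal Dirichlet series `∑ aₙ n^{-s}` with coefficients in `X`, given by `(aₙ)_{n ≥ 1}`. -/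
abbrev DirichletSeries (X : Type*) : Type _ := ℕ+ → X

/-- `𝔭^α = ∏ᵢ 𝔭ᵢ^{αᵢ}`, where `𝔭` is the increasing sequence of the primes. -/
noncomputable def primePow (α : ℕ →₀ ℕ) : ℕ+ :=
  ⟨α.prod fun i k => Nat.nth Nat.Prime i ^ k,
    Finset.prod_pos fun i _ => pow_pos (Nat.prime_nth_prime i).pos _⟩

theorem nthPrime_injective : Function.Injective (Nat.nth Nat.Prime) :=
  Nat.nth_injective Nat.infinite_setOfPred_prime

theorem factorization_primePow (α : ℕ →₀ ℕ) :
    (primePow α : ℕ).factorization = α.mapDomain (Nat.nth Nat.Prime) := by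
  have : (primePow α : ℕ) = (α.mapDomain (Nat.nth Nat.Prime)).prod (· ^ ·) := by
    rw [Finsupp.prod_mapDomain_index_inj nthPrime_injective]; rfl
  rw [this]
  refine Nat.prod_pow_factorization_eq_self fun q hq => ?_
  obtain ⟨i, -, rfl⟩ := Finset.mem_image.mp (Finsupp.mapDomain_support hq)
  exact Nat.prime_nth_prime i

/-- Unique factorization: `α ↦ 𝔭^α` is a bijection onto the positive integers. -/
theorem primePow_bijective : Function.Bijective primePow := by
  constructor
  · intro α β h
    refine Finsupp.mapDomain_injective nthPrime_injective ?_
    rw [← factorization_primePow, ← factorization_primePow, h]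
  · intro n
    refine ⟨(n : ℕ).factorization.comapDomain _ nthPrime_injective.injOn, ?_⟩
    refine PNat.eq (Nat.eq_of_factorization_eq' (PNat.ne_zero _) (PNat.ne_zero _) ?_)
    rw [factorization_primePow]
    refine Finsupp.mapDomain_comapDomain _ nthPrime_injective _ fun q hq => ?_
    have hq' : q.Prime := Nat.prime_of_mem_primeFactors (n := n) (by simpa using hq)
    exact ⟨Nat.count Nat.Prime q, Nat.nth_count hq'⟩

/-- The Bohr transform `∑ c_α z^α ↦ ∑ aₙ n^{-s}`, where `aₙ = c_α` if `n = 𝔭^α`. -/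
noncomputable def bohr (X : Type*) [AddCommGroup X] [Module ℂ X] :
    ((ℕ →₀ ℕ) → X) ≃ₗ[ℂ] DirichletSeries X :=
  LinearEquiv.funCongrLeft ℂ X (Equiv.ofBijective primePow primePow_bijective).symm

theorem bohr_primePow {X : Type*} [AddCommGroup X] [Module ℂ X] (c : (ℕ →₀ ℕ) → X)
    (α : ℕ →₀ ℕ) : bohr X c (primePow α) = c α := by
  change c ((Equiv.ofBijective primePow primePow_bijective).symm
    (Equiv.ofBijective primePow primePow_bijective α)) = c α
  rw [Equiv.symm_apply_apply]

/-- The translation `D_z = ∑ (aₙ / n^z) n^{-s}` of `D = ∑ aₙ n^{-s}`. -/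
noncomputable def translate {X : Type*} [AddCommGroup X] [Module ℂ X] (z : ℂ) :
    DirichletSeries X →ₗ[ℂ] DirichletSeries X where
  toFun D n := (1 / ((n : ℕ) : ℂ) ^ z) • D n
  map_add' D E := by ext n; simp
  map_smul' c D := by ext n; simp only [Pi.smul_apply, RingHom.id_apply]; rw [smul_comm]

theorem translate_injective {X : Type*} [AddCommGroup X] [Module ℂ X] (z : ℂ) :
    Function.Injective (translate (X := X) z) := by
  intro D E h
  ext n
  have hn : (1 / ((n : ℕ) : ℂ) ^ z) ≠ 0 :=
    one_div_ne_zero (by simp [Complex.cpow_eq_zero_iff])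
  exact smul_right_injective X hn (congrFun h n)

/-! ### Hardy spaces -/

section

variable (p : ℝ≥0∞) [Fact (1 ≤ p)] (X : Type*) [NormedAddCommGroup X] [NormedSpace ℂ X]

/-- The inclusion of `ℕ₀^{(ℕ)}` into `ℤ^{(ℕ)}`. -/
noncomputable def toInt (α : ℕ →₀ ℕ) : ℕ →₀ ℤ := α.mapRange (fun n : ℕ => (n : ℤ)) rfl

/-- `H_p(𝕋^ℕ, X)`: the functions in `L_p(𝕋^ℕ, X)` whose Fourier coefficients vanish at every
`α ∈ ℤ^{(ℕ)}` having a negative entry. -/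
noncomputable def hardyTorus : Submodule ℂ (Lp X p haar) where
  carrier := {f | ∀ α : ℕ →₀ ℤ, (∃ i, α i < 0) → fourierCoeff f α = 0}
  add_mem' hf hg α hα := by rw [fourierCoeff_add, hf α hα, hg α hα, add_zero]
  zero_mem' α _ := by
    have := fourierCoeff_smul (0 : ℂ) (0 : Lp X p haar) α
    rwa [zero_smul, zero_smul] at this
  smul_mem' c f hf α hα := by rw [fourierCoeff_smul, hf α hα, smul_zero]

/-- The Bohr transform of the Fourier series of a function in `H_p(𝕋^ℕ, X)`. -/
noncomputable def hardyBohr : hardyTorus p X →ₗ[ℂ] DirichletSeries X :=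
  (bohr X).toLinearMap ∘ₗ
    { toFun := fun f α => fourierCoeff (f : Lp X p haar) (toInt α)
      map_add' := fun f g => funext fun _ => fourierCoeff_add (f : Lp X p haar) g _
      map_smul' := fun c f => funext fun _ => fourierCoeff_smul c (f : Lp X p haar) _ }

theorem hardyBohr_injective [CompleteSpace X] : Function.Injective (hardyBohr p X) := by
  rw [injective_iff_map_eq_zero]
  intro f hf
  have hc : ∀ α : ℕ →₀ ℕ, fourierCoeff (f : Lp X p haar) (toInt α) = 0 := fun α => by
    have := congrFun hf (primePow α)
    rwa [hardyBohr, LinearMap.comp_apply, LinearEquiv.coe_coe, bohr_primePow] at this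
  have hall : ∀ α : ℕ →₀ ℤ, fourierCoeff (f : Lp X p haar) α = 0 := fun α => by
    by_cases hα : ∃ i, α i < 0
    · exact f.2 α hα
    · push Not at hα
      have : α = toInt (α.mapRange Int.toNat rfl) := by
        ext i; simp [toInt, hα i]
      rw [this]; exact hc _
  refine Subtype.ext (Lp.eq_zero_iff_ae_eq_zero.mpr ?_)
  exact ae_eq_zero_of_fourierCoeff (integrable_Lp _) hall

/-- `𝓗_p(X)`: the image of `H_p(𝕋^ℕ, X)` under the Bohr transform. -/
noncomputable def hardyDirichlet : Submodule ℂ (DirichletSeries X) :=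
  LinearMap.range (hardyBohr p X)

variable [CompleteSpace X]

/-- The Bohr transform as a linear bijection from `H_p(𝕋^ℕ, X)` onto `𝓗_p(X)`. -/
noncomputable def hardyBohrEquiv : hardyTorus p X ≃ₗ[ℂ] hardyDirichlet p X :=
  LinearEquiv.ofInjective (hardyBohr p X) (hardyBohr_injective p X)

/-- `𝓗_p(X)` carries the norm that makes the Bohr transform `H_p(𝕋^ℕ, X) → 𝓗_p(X)` an isometry. -/
noncomputable instance instNormedAddCommGroupHardyDirichlet :
    NormedAddCommGroup (hardyDirichlet p X) :=
  NormedAddCommGroup.induced _ _ (hardyBohrEquiv p X).symm.toLinearMap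
    (hardyBohrEquiv p X).symm.injective

noncomputable instance instNormedSpaceHardyDirichlet : NormedSpace ℂ (hardyDirichlet p X) :=
  NormedSpace.induced ℂ _ _ (hardyBohrEquiv p X).symm.toLinearMap

/-- `𝓗_p⁺(X)`: the Dirichlet series `D` with `D_ε ∈ 𝓗_p(X)` for all real `ε > 0` and
`sup_{ε > 0} ‖D_ε‖_{𝓗_p(X)} < ∞`. -/
noncomputable def hardyPlus : Submodule ℂ (DirichletSeries X) where
  carrier := {D | ∃ h : ∀ ε : Set.Ioi (0 : ℝ), translate ((ε : ℝ) : ℂ) D ∈ hardyDirichlet p X,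
    BddAbove (Set.range fun ε => ‖(⟨_, h ε⟩ : hardyDirichlet p X)‖)}
  add_mem' := by
    rintro D E ⟨hD, C, hC⟩ ⟨hE, C', hC'⟩
    refine ⟨fun ε => ?_, C + C', ?_⟩
    · rw [map_add]; exact add_mem (hD ε) (hE ε)
    · rintro - ⟨ε, rfl⟩
      have := (norm_add_le (⟨_, hD ε⟩ : hardyDirichlet p X) ⟨_, hE ε⟩).trans
        (add_le_add (hC ⟨ε, rfl⟩) (hC' ⟨ε, rfl⟩))
      refine le_trans (le_of_eq (congrArg norm ?_)) this
      exact Subtype.ext (map_add (translate ((ε : ℝ) : ℂ)) D E)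
  zero_mem' := by
    refine ⟨fun ε => ?_, 0, ?_⟩
    · rw [map_zero]; exact zero_mem _
    · rintro - ⟨ε, rfl⟩
      refine (norm_eq_zero.mpr ?_).le
      exact Subtype.ext (map_zero _)
  smul_mem' := by
    rintro c D ⟨hD, C, hC⟩
    refine ⟨fun ε => ?_, ‖c‖ * C, ?_⟩
    · rw [map_smul]; exact Submodule.smul_mem _ c (hD ε)
    · rintro - ⟨ε, rfl⟩
      have := mul_le_mul_of_nonneg_left (hC ⟨ε, rfl⟩) (norm_nonneg c)
      rw [← norm_smul] at this
      refine le_trans (le_of_eq (congrArg norm ?_)) this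
      exact Subtype.ext (map_smul (translate ((ε : ℝ) : ℂ)) c D)

variable {p X}

/-- The map `D ↦ D_ε` from `𝓗_p⁺(X)` to `𝓗_p(X)`. -/
noncomputable def hardyPlus.translate (ε : Set.Ioi (0 : ℝ)) :
    hardyPlus p X →ₗ[ℂ] hardyDirichlet p X where
  toFun D := ⟨BohrHardy.translate ((ε : ℝ) : ℂ) D, D.2.1 ε⟩
  map_add' _ _ := Subtype.ext (map_add _ _ _)
  map_smul' _ _ := Subtype.ext (map_smul _ _ _)

/-- `‖D‖_{𝓗_p⁺(X)} = sup_{ε > 0} ‖D_ε‖_{𝓗_p(X)}`. -/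
noncomputable instance instNormHardyPlus : Norm (hardyPlus p X) :=
  ⟨fun D => ⨆ ε : Set.Ioi (0 : ℝ), ‖hardyPlus.translate ε D‖⟩

theorem hardyPlus.norm_def (D : hardyPlus p X) :
    ‖D‖ = ⨆ ε : Set.Ioi (0 : ℝ), ‖hardyPlus.translate ε D‖ := rfl

theorem hardyPlus.norm_translate_le (D : hardyPlus p X) (ε : Set.Ioi (0 : ℝ)) :
    ‖hardyPlus.translate ε D‖ ≤ ‖D‖ :=
  le_ciSup (f := fun ε => ‖hardyPlus.translate ε D‖) D.2.2 ε

theorem hardyPlus.core : NormedSpace.Core ℂ (hardyPlus p X) where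
  norm_nonneg D := Real.iSup_nonneg fun _ => norm_nonneg _
  norm_smul c D := by
    simp only [hardyPlus.norm_def, map_smul, norm_smul]
    exact (Real.mul_iSup_of_nonneg (norm_nonneg c) _).symm
  norm_triangle D E := by
    have : Nonempty (Set.Ioi (0 : ℝ)) := ⟨⟨1, Set.mem_Ioi.mpr one_pos⟩⟩
    rw [hardyPlus.norm_def]
    refine ciSup_le fun ε => ?_
    rw [map_add]
    exact (norm_add_le _ _).trans
      (add_le_add (hardyPlus.norm_translate_le D ε) (hardyPlus.norm_translate_le E ε))
  norm_eq_zero_iff D := by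
    constructor
    · intro h
      have h1 := hardyPlus.norm_translate_le D ⟨1, Set.mem_Ioi.mpr one_pos⟩
      rw [h] at h1
      have h2 := congrArg Subtype.val (norm_le_zero_iff.mp h1)
      refine Subtype.ext (translate_injective ((1 : ℝ) : ℂ) ?_)
      exact h2.trans (map_zero _).symm
    · rintro rfl
      simp [hardyPlus.norm_def]

noncomputable instance instNormedAddCommGroupHardyPlus : NormedAddCommGroup (hardyPlus p X) :=
  NormedAddCommGroup.ofCore hardyPlus.core

noncomputable instance instNormedSpaceHardyPlus : NormedSpace ℂ (hardyPlus p X) :=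
  NormedSpace.ofCore hardyPlus.core

end

/-! ### The spaces `E_p(𝕋^ℕ, X)` and the functionals of analytic type

`E_p(𝕋^ℕ, X)` is `L_p(𝕋^ℕ, X)` for `p < ∞` and `C(𝕋^ℕ, X)` for `p = ∞`. -/

section

variable (p : ℝ≥0∞) [Fact (1 ≤ p)] (X : Type*) [NormedAddCommGroup X] [NormedSpace ℂ X]

variable {X} in
/-- The elementary tensor `ω^α ⊗ x` in `C(𝕋^ℕ, X)`. -/
noncomputable def tensor (α : ℕ →₀ ℤ) (x : X) : C(Torus, X) where
  toFun ω := mono α ω • x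
  continuous_toFun := (mono α).continuous.smul continuous_const

variable {X} in
/-- The elementary tensor `ω^α ⊗ x` in `L_p(𝕋^ℕ, X)`. -/
noncomputable def tensorLp (α : ℕ →₀ ℤ) (x : X) : Lp X p haar :=
  ContinuousMap.toLp p haar ℂ (tensor α x)

/-- The functionals on `L_p(𝕋^ℕ, X)` that vanish on `ω^{-α} ⊗ x` for every `x` and every
`α ∈ ℤ^{(ℕ)}` having a negative entry. -/
noncomputable def dualPlusLp : Submodule ℂ (StrongDual ℂ (Lp X p haar)) where
  carrier := {f | ∀ (α : ℕ →₀ ℤ) (x : X), (∃ i, α i < 0) → f (tensorLp p (-α) x) = 0}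
  add_mem' hf hg α x hα := by simp [hf α x hα, hg α x hα]
  zero_mem' _ _ _ := rfl
  smul_mem' c f hf α x hα := by simp [hf α x hα]

/-- The functionals on `C(𝕋^ℕ, X)` that vanish on `ω^{-α} ⊗ x` for every `x` and every
`α ∈ ℤ^{(ℕ)}` having a negative entry. -/
noncomputable def dualPlusC : Submodule ℂ (StrongDual ℂ C(Torus, X)) where
  carrier := {f | ∀ (α : ℕ →₀ ℤ) (x : X), (∃ i, α i < 0) → f (tensor (-α) x) = 0}
  add_mem' hf hg α x hα := by simp [hf α x hα, hg α x hα]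
  zero_mem' _ _ _ := rfl
  smul_mem' c f hf α x hα := by simp [hf α x hα]

end

end BohrHardy

namespace BohrHardy

open MeasureTheory

/-! ### The Cauchy and the Gaussian kernel -/

section

open ProbabilityTheory FourierTransform
open scoped NNReal Real

/-! A functional on `L_p(𝕋^ℕ, X)` or `C(𝕋^ℕ, X)` need not be given by an `X^*`-valued function,
since `X^*` is arbitrary. The point is that after the damping `a_n ↦ a_n n^{-ε}` a functional of
analytic type is given by one, of norm at most `‖f‖` in `L_q`.

Write `b_α(x) = f(ω^α ⊗ x)` and `L = log 𝔭^α`. Composing with the Kronecker flow `t ↦ (𝔭ᵢ^{it})ᵢ`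
multiplies `b_α` by `e^{itL}` and preserves all norms. Averaging over `t` against a kernel on `ℝ`
therefore gives a multiplier of norm at most the `L_1` norm of the kernel. The Cauchy density of
scale `ε` gives `e^{-ε|L|}`, which is `n^{-ε}` on the indices that matter, and this multiplier is a
contraction (`norm_dualForm_cauchy_le`).

To obtain a function, damp further by `e^{-δ²L²/2}`. The coefficients, supported on `ℕ₀^{(ℕ)}`,
become absolutely summable (`summable_cauchy_mul_gaussian`) and define a continuous function. Its
`L_q` norm can be tested against continuous functions (`norm_toLp_le_of_pairing_le`), with no
Radon-Nikodym property. The Cauchy density is Lipschitz under translation in `L_1`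
(`integral_abs_cauchyPDFReal_sub_le`), so the Gaussian factor costs only `O(δ)`; the functions
converge in `L_q` as `δ → 0`, also for `q = ∞` (`exists_Lp_fourierCoeff_eq`).

Conversely, for `D` in `𝓗_q⁺(X^*)`, Hölder's inequality for the functions of `D_ε` bounds the form
`∑ b_α(c_α)` after damping; letting `ε → 0` in this finite sum gives the bound `‖D‖`
(`norm_dualForm_dirichletCoeff_le`). Density of trigonometric polynomials then yields the functional
and the missing norm inequality. Both choices of `E_p` are treated at once through a map `ι : C(𝕋^ℕ,
X) → E` of dense range that induces the `L_p` norm. -/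

theorem integrable_exp_neg_mul_abs {γ : ℝ} (hγ : 0 < γ) :
    Integrable fun u : ℝ => Complex.exp (-(γ * |u| : ℝ)) := by
  rw [← integrableOn_univ, ← Set.Iic_union_Ioi (a := (0 : ℝ))]
  refine IntegrableOn.union ?_ ?_
  · refine (integrableOn_exp_mul_complex_Iic (a := (γ : ℂ)) (by simpa) 0).congr_fun
      (fun u hu => ?_) measurableSet_Iic
    rw [abs_of_nonpos (Set.mem_Iic.mp hu)]
    push_cast; ring_nf
  · refine (integrableOn_exp_mul_complex_Ioi (a := (-γ : ℂ)) (by simpa) 0).congr_fun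
      (fun u hu => ?_) measurableSet_Ioi
    rw [abs_of_pos (Set.mem_Ioi.mp hu)]
    push_cast; ring_nf

theorem fourier_exp_neg_mul_abs {γ : ℝ≥0} (hγ : γ ≠ 0) (w : ℝ) :
    𝓕 (fun u : ℝ => Complex.exp (-(γ * |u| : ℝ))) w =
      (2 * π * cauchyPDFReal 0 γ (2 * π * w) : ℝ) := by
  have hγ0 : (0 : ℝ) < γ := by positivity
  have hint : Integrable fun u : ℝ =>
      Complex.exp (↑(-2 * π * u * w) * Complex.I) • Complex.exp (-(γ * |u| : ℝ)) := by
    refine (integrable_exp_neg_mul_abs hγ0).mono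
      (Continuous.aestronglyMeasurable (by fun_prop)) (.of_forall fun u => ?_)
    rw [norm_smul, Complex.norm_exp_ofReal_mul_I, one_mul]
  rw [Real.fourier_eq']
  simp only [RCLike.inner_apply, conj_trivial]
  have e : ∀ u : ℝ, (-2 * π * (w * u)) = -2 * π * u * w := fun u => by ring
  simp only [e]
  rw [← intervalIntegral.integral_Iic_add_Ioi hint.integrableOn hint.integrableOn (b := 0)]
  have h1 : ∫ u in Set.Iic (0 : ℝ),
      Complex.exp (↑(-2 * π * u * w) * Complex.I) • Complex.exp (-(γ * |u| : ℝ)) =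
      ∫ u in Set.Iic (0 : ℝ), Complex.exp ((γ - 2 * π * w * Complex.I) * u) := by
    refine setIntegral_congr_fun measurableSet_Iic fun u hu => ?_
    simp only [smul_eq_mul]
    rw [abs_of_nonpos (Set.mem_Iic.mp hu), ← Complex.exp_add]
    congr 1; push_cast; ring
  have h2 : ∫ u in Set.Ioi (0 : ℝ),
      Complex.exp (↑(-2 * π * u * w) * Complex.I) • Complex.exp (-(γ * |u| : ℝ)) =
      ∫ u in Set.Ioi (0 : ℝ), Complex.exp ((-γ - 2 * π * w * Complex.I) * u) := by
    refine setIntegral_congr_fun measurableSet_Ioi fun u hu => ?_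
    simp only [smul_eq_mul]
    rw [abs_of_pos (Set.mem_Ioi.mp hu), ← Complex.exp_add]
    congr 1; push_cast; ring
  have r1 : ((γ : ℂ) - 2 * π * w * Complex.I).re = γ := by simp
  have r2 : (-(γ : ℂ) - 2 * π * w * Complex.I).re = -γ := by simp
  rw [h1, h2, integral_exp_mul_complex_Iic (by rw [r1]; exact hγ0),
    integral_exp_mul_complex_Ioi (by rw [r2]; simpa using hγ0), cauchyPDFReal_def]
  have n1 : (γ : ℂ) - 2 * π * w * Complex.I ≠ 0 := fun h => by
    rw [h] at r1; exact hγ0.ne r1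
  have n2 : -(γ : ℂ) - 2 * π * w * Complex.I ≠ 0 := fun h => by
    rw [h] at r2; exact hγ0.ne' (by simpa using r2)
  have n3 : ((2 * π * w) ^ 2 + γ ^ 2 : ℂ) ≠ 0 := by
    have : 0 < (2 * π * w) ^ 2 + (γ : ℝ) ^ 2 := by positivity
    exact_mod_cast this.ne'
  have n4 : (π : ℂ) ≠ 0 := by exact_mod_cast Real.pi_ne_zero
  have n5 : ((2 * π * w) ^ 2 + γ ^ 2 : ℂ) =
      -(((γ : ℂ) - 2 * π * w * Complex.I) * (-(γ : ℂ) - 2 * π * w * Complex.I)) := by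
    linear_combination (2 * π * w : ℂ) ^ 2 * Complex.I_sq
  push_cast
  simp only [mul_zero, Complex.exp_zero, sub_zero]
  rw [n5] at n3 ⊢
  field_simp
  ring

/-- The characteristic function of the Cauchy distribution. -/
theorem integral_exp_mul_cauchyPDFReal {γ : ℝ≥0} (hγ : γ ≠ 0) (L : ℝ) :
    ∫ t : ℝ, (cauchyPDFReal 0 γ t : ℂ) * Complex.exp (t * L * Complex.I) =
      Complex.exp (-(γ * |L| : ℝ)) := by
  have hγ0 : (0 : ℝ) < γ := by positivity
  have hF : 𝓕 (fun u : ℝ => Complex.exp (-(γ * |u| : ℝ))) =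
      fun w : ℝ => ((2 * π * cauchyPDFReal 0 γ (2 * π * w) : ℝ) : ℂ) :=
    funext (fourier_exp_neg_mul_abs hγ)
  have hFi : Integrable (𝓕 (fun u : ℝ => Complex.exp (-(γ * |u| : ℝ)))) := by
    rw [hF]
    exact (((integrable_cauchyPDFReal 0).comp_mul_left' (by positivity : 2 * π ≠ 0)).const_mul
      _).ofReal
  have hinv := congrFun (Continuous.fourierInv_fourier_eq (by fun_prop)
    (integrable_exp_neg_mul_abs hγ0) hFi) L
  rw [← hinv, hF, Real.fourierInv_eq']
  -- The substitution `t = 2πw` removes the `2π` from the convention for the Fourier transform.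
  have hsub := Measure.integral_comp_mul_left (fun t : ℝ =>
    (cauchyPDFReal 0 γ t : ℂ) * Complex.exp (t * L * Complex.I)) (2 * π)
  have hpi : (2 * π : ℝ) ≠ 0 := by positivity
  rw [abs_of_nonneg (by positivity), eq_inv_smul_iff₀ hpi, ← integral_smul] at hsub
  rw [← hsub]
  refine integral_congr_ae (.of_forall fun w => ?_)
  simp only [RCLike.inner_apply, conj_trivial, Complex.real_smul, smul_eq_mul]
  push_cast
  ring_nf

/-- Over a common denominator the difference of the densities carries the factor `|h| |t + (t -
h)|`, and `2γ|t| ≤ t² + γ²` bounds this by the denominators themselves. Linear decay in `|h|` is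
what makes the Gaussian regularization converge in norm. -/
theorem integral_abs_cauchyPDFReal_sub_le {γ : ℝ≥0} (hγ : γ ≠ 0) (h : ℝ) :
    ∫ t : ℝ, |cauchyPDFReal 0 γ t - cauchyPDFReal 0 γ (t - h)| ≤ |h| / γ := by
  have hγ0 : (0 : ℝ) < γ := by positivity
  have hi := integrable_cauchyPDFReal 0 (γ := γ)
  have key : ∀ t, |cauchyPDFReal 0 γ t - cauchyPDFReal 0 γ (t - h)| ≤
      |h| / (2 * γ) * (cauchyPDFReal 0 γ t + cauchyPDFReal 0 γ (t - h)) := by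
    intro t
    simp only [cauchyPDFReal_def, sub_zero]
    set a := t ^ 2 + (γ : ℝ) ^ 2 with ha
    set b := (t - h) ^ 2 + (γ : ℝ) ^ 2 with hb
    have ha0 : 0 < a := by positivity
    have hb0 : 0 < b := by positivity
    have e1 : π⁻¹ * γ * a⁻¹ - π⁻¹ * γ * b⁻¹ = (π⁻¹ * γ * a⁻¹ * b⁻¹) * (b - a) := by
      field_simp
    have e2 : |h| / (2 * γ) * (π⁻¹ * γ * a⁻¹ + π⁻¹ * γ * b⁻¹) =
        (π⁻¹ * γ * a⁻¹ * b⁻¹) * (|h| / (2 * γ) * (b + a)) := by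
      field_simp
    rw [e1, e2, abs_mul, abs_of_nonneg (by positivity : 0 ≤ π⁻¹ * γ * a⁻¹ * b⁻¹)]
    refine mul_le_mul_of_nonneg_left ?_ (by positivity)
    have e3 : b - a = -h * (t + (t - h)) := by rw [ha, hb]; ring
    have e4 : |h| / (2 * γ) * (b + a) = |h| * ((b + a) / (2 * γ)) := by ring
    rw [e3, abs_mul, abs_neg, e4]
    refine mul_le_mul_of_nonneg_left ?_ (abs_nonneg h)
    rw [le_div_iff₀ (by positivity)]
    have h1 := abs_add_le t (t - h)
    have h2 : 2 * γ * |t| ≤ a := by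
      rw [ha]; nlinarith [sq_nonneg (|t| - γ), sq_abs t]
    have h3 : 2 * γ * |t - h| ≤ b := by
      rw [hb]; nlinarith [sq_nonneg (|t - h| - γ), sq_abs (t - h)]
    nlinarith
  have hi' := hi.comp_sub_right h
  refine (integral_mono (hi.sub hi').abs ((hi.add hi').const_mul _) key).trans (le_of_eq ?_)
  simp only [Pi.add_apply]
  rw [integral_const_mul, integral_add hi hi', integral_sub_right_eq_self (cauchyPDFReal 0 γ) h,
    integral_cauchyPDFReal_eq_one 0 hγ]
  field_simp
  norm_num

theorem integrable_mul_exp {k : ℝ → ℝ} (hk : Integrable k) (L : ℝ) :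
    Integrable fun t : ℝ => (k t : ℂ) * Complex.exp (t * L * Complex.I) := by
  have h : AEStronglyMeasurable (fun t : ℝ => Complex.exp (t * L * Complex.I)) :=
    Continuous.aestronglyMeasurable (by fun_prop)
  refine hk.mono ((Complex.continuous_ofReal.comp_aestronglyMeasurable hk.1).mul h)
    (.of_forall fun t => ?_)
  rw [norm_mul, ← Complex.ofReal_mul, Complex.norm_exp_ofReal_mul_I, mul_one, Complex.norm_real]

theorem integral_exp_mul_gaussianReal (δ L : ℝ) :
    ∫ s : ℝ, Complex.exp (δ * s * L * Complex.I) ∂(gaussianReal 0 1) =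
      Complex.exp (-(δ ^ 2 * L ^ 2 / 2 : ℝ)) := by
  have h := charFun_gaussianReal (μ := 0) (v := 1) (δ * L)
  rw [charFun_apply_real] at h
  convert h using 2
  · ext s; push_cast; ring_nf
  · push_cast; ring_nf

end

/-! ### The Kronecker flow and trigonometric polynomials -/

theorem mono_mul_apply (α : ℕ →₀ ℤ) (ω η : Torus) : mono α (ω * η) = mono α ω * mono α η := by
  simp only [mono, ContinuousMap.coe_mk, ← Circle.coe_mul, Finsupp.prod, Pi.mul_apply, mul_zpow,
    Finset.prod_mul_distrib]

theorem mono_circleExp (α : ℕ →₀ ℤ) (s : ℕ → ℝ) :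
    mono α (fun i => Circle.exp (s i)) =
      Complex.exp ((α.sum fun i k => (k : ℝ) * s i : ℝ) * Complex.I) := by
  simp only [mono, ContinuousMap.coe_mk, Finsupp.prod, Finsupp.sum, Complex.ofReal_sum,
    Finset.sum_mul, Complex.exp_sum]
  refine (map_prod Circle.coeHom _ _).trans ?_
  refine Finset.prod_congr rfl fun i _ => ?_
  change ((Circle.exp (s i) ^ α i : Circle) : ℂ) = _
  rw [Circle.coe_zpow, Circle.coe_exp, ← Complex.exp_int_mul]
  push_cast
  ring_nf

theorem integral_mono_eq_ite (α : ℕ →₀ ℤ) : ∫ ω, mono α ω ∂haar = if α = 0 then 1 else 0 := by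
  split_ifs with h
  · simp [h, mono_zero]
  · obtain ⟨i, hi⟩ := Finsupp.ne_iff.mp h
    have hi' : ((α i : ℤ) : ℝ) ≠ 0 := by exact_mod_cast hi
    -- A rotation in the single coordinate `i` under which `ω^α` changes sign; by invariance the
    -- integral equals its own negative.
    set η : Torus := fun j => Circle.exp ((Pi.single i (Real.pi / α i) : ℕ → ℝ) j)
    have hη : mono α η = -1 := by
      rw [mono_circleExp, Finsupp.sum, Finset.sum_eq_single i]
      · rw [Pi.single_eq_same, mul_div_cancel₀ _ hi', Complex.exp_pi_mul_I]
      · intro j _ hj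
        rw [Pi.single_eq_of_ne hj, mul_zero]
      · intro hi2
        exact absurd (Finsupp.notMem_support_iff.mp hi2) hi
    have h1 := integral_mul_left_eq_self (μ := haar) (fun ω => mono α ω) η
    simp only [mono_mul_apply, hη, neg_mul, one_mul, integral_neg] at h1
    exact self_eq_neg.mp h1.symm

/-- `log 𝔭^α = ∑ᵢ αᵢ log 𝔭ᵢ`, for `α ∈ ℤ^{(ℕ)}`. -/
noncomputable def logPrime (α : ℕ →₀ ℤ) : ℝ :=
  α.sum fun i k => (k : ℝ) * Real.log (Nat.nth Nat.Prime i)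

/-- The Kronecker flow `t ↦ (𝔭ᵢ^{it})ᵢ`. -/
noncomputable def flow (t : ℝ) : Torus := fun i => Circle.exp (t * Real.log (Nat.nth Nat.Prime i))

/-- Characters of the torus restrict to exponentials of frequency `log 𝔭^α` along the flow, so
Fourier transforms of kernels on `ℝ` become multipliers on `ℤ^{(ℕ)}`. -/
theorem mono_flow (α : ℕ →₀ ℤ) (t : ℝ) :
    mono α (flow t) = Complex.exp (t * logPrime α * Complex.I) := by
  unfold flow
  rw [mono_circleExp, logPrime, Finsupp.sum, Finsupp.sum]
  congr 2
  rw [← Complex.ofReal_mul, Finset.mul_sum]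
  congr 1
  exact Finset.sum_congr rfl fun i _ => by ring

theorem logPrime_neg (α : ℕ →₀ ℤ) : logPrime (-α) = -logPrime α := by
  rw [logPrime, Finsupp.sum_neg_index (by simp), logPrime, Finsupp.sum, Finsupp.sum,
    ← Finset.sum_neg_distrib]
  exact Finset.sum_congr rfl fun i _ => by push_cast; ring

theorem logPrime_toInt (α : ℕ →₀ ℕ) : logPrime (toInt α) = Real.log (primePow α : ℕ) := by
  rw [logPrime, toInt, Finsupp.sum_mapRange_index (by simp)]
  change _ = Real.log ((α.prod fun i k => Nat.nth Nat.Prime i ^ k : ℕ) : ℝ)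
  rw [Finsupp.prod, Nat.cast_prod, Real.log_prod, Finsupp.sum]
  · exact Finset.sum_congr rfl fun i _ => by simp
  · intro i _
    exact_mod_cast (pow_pos (Nat.prime_nth_prime i).pos _).ne'

section

variable {X : Type*} [NormedAddCommGroup X] [NormedSpace ℂ X]

/-- The trigonometric polynomial `∑ c_α ω^α`. -/
noncomputable def trigPolynomial (X : Type*) [NormedAddCommGroup X] [NormedSpace ℂ X] :
    ((ℕ →₀ ℤ) →₀ X) →ₗ[ℂ] C(Torus, X) :=
  Finsupp.lsum ℂ fun α =>
    { toFun := tensor α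
      map_add' := fun x y => by ext ω; simp [tensor]
      map_smul' := fun c x => by ext ω; simp [tensor, smul_comm c] }

theorem trigPolynomial_single (α : ℕ →₀ ℤ) (x : X) :
    trigPolynomial X (Finsupp.single α x) = tensor α x := by
  rw [trigPolynomial, Finsupp.lsum_single]
  rfl

theorem trigPolynomial_apply (c : (ℕ →₀ ℤ) →₀ X) :
    trigPolynomial X c = c.sum fun α x => tensor α x := by
  rw [trigPolynomial, Finsupp.coe_lsum]
  rfl

/-- A partition of unity subordinate to finitely many sets on which `h` is `δ`-close to `h a` does
it. This reduces vector-valued density to scalar density. -/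
theorem exists_norm_sub_sum_smul_lt {K : Type*} [TopologicalSpace K] [CompactSpace K] [T2Space K]
    (h : C(K, X)) {δ : ℝ} (hδ : 0 < δ) :
    ∃ (s : Finset K) (g : s → C(K, ℂ)),
      ‖h - ∑ a : s, (ContinuousLinearMap.toSpanSingleton ℂ (h a)).compLeftContinuous ℂ K (g a)‖
        ≤ δ := by
  obtain ⟨s, hs⟩ := isCompact_univ.elim_finite_subcover (fun a : K => {y | dist (h y) (h a) < δ})
    (fun a => isOpen_lt (by fun_prop) continuous_const)
    (fun y _ => Set.mem_iUnion.mpr ⟨y, by simpa⟩)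
  obtain ⟨ρ, hρ⟩ := PartitionOfUnity.exists_isSubordinate (X := K) (s := Set.univ) isClosed_univ
    (fun a : s => {y | dist (h y) (h a) < δ}) (fun a => isOpen_lt (by fun_prop) continuous_const)
    (fun y hy => by
      obtain ⟨a, ha, hy'⟩ := Set.mem_iUnion₂.mp (hs hy)
      exact Set.mem_iUnion.mpr ⟨⟨a, ha⟩, hy'⟩)
  refine ⟨s, fun a => ⟨fun y => (ρ a y : ℂ), by fun_prop⟩, ?_⟩
  rw [ContinuousMap.norm_le _ hδ.le]
  intro y
  have h1 : ∑ a, ρ a y = 1 := by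
    rw [← finsum_eq_sum_of_fintype]; exact ρ.sum_eq_one (Set.mem_univ y)
  have h2 : (h - ∑ a : s, (ContinuousLinearMap.toSpanSingleton ℂ (h a)).compLeftContinuous ℂ K
      ⟨fun y => (ρ a y : ℂ), by fun_prop⟩) y = ∑ a : s, ρ a y • (h y - h a) := by
    simp only [smul_sub, Finset.sum_sub_distrib, ← Finset.sum_smul, h1, one_smul]
    simp
  rw [h2]
  refine (norm_sum_le _ _).trans ?_
  calc ∑ a : s, ‖ρ a y • (h y - h a)‖ ≤ ∑ a : s, ρ a y * δ := by
        refine Finset.sum_le_sum fun a _ => ?_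
        rw [norm_smul, Real.norm_of_nonneg (ρ.nonneg a y)]
        by_cases hy : ρ a y = 0
        · simp [hy]
        · have := hρ a (subset_tsupport _ hy)
          rw [Set.mem_ofPred_eq, dist_eq_norm] at this
          exact mul_le_mul_of_nonneg_left this.le (ρ.nonneg a y)
    _ = δ := by rw [← Finset.sum_mul, h1, one_mul]

theorem denseRange_trigPolynomial : DenseRange (trigPolynomial X) := by
  set V := (LinearMap.range (trigPolynomial X)).topologicalClosure with hV
  -- The closure contains every `g ⊗ x`, by scalar Stone-Weierstrass.
  have h1 : ∀ (x : X) (g : C(Torus, ℂ)),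
      (ContinuousLinearMap.toSpanSingleton ℂ x).compLeftContinuous ℂ Torus g ∈ V := by
    intro x g
    have hle : (Submodule.span ℂ (Set.range mono)).topologicalClosure ≤
        V.comap ((ContinuousLinearMap.toSpanSingleton ℂ x).compLeftContinuous ℂ Torus :
          C(Torus, ℂ) →ₗ[ℂ] C(Torus, X)) := by
      refine Submodule.topologicalClosure_minimal _ (Submodule.span_le.mpr ?_) ?_
      · rintro - ⟨α, rfl⟩
        refine Submodule.le_topologicalClosure _ ⟨Finsupp.single α x, ?_⟩
        rw [trigPolynomial_single]
        ext ω
        simp [tensor]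
      · exact (Submodule.isClosed_topologicalClosure _).preimage
          (ContinuousLinearMap.continuous _)
    rw [span_mono_closure] at hle
    exact hle trivial
  intro h
  have hmem : h ∈ closure (V : Set C(Torus, X)) := by
    rw [Metric.mem_closure_iff]
    intro δ hδ
    obtain ⟨s, g, hg⟩ := exists_norm_sub_sum_smul_lt h (half_pos hδ)
    refine ⟨_, V.sum_mem (t := Finset.univ) fun (a : s) _ => h1 (h a) (g a), ?_⟩
    rw [dist_eq_norm]
    exact hg.trans_lt (half_lt_self hδ)
  rw [(Submodule.isClosed_topologicalClosure _).closure_eq] at hmem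
  exact hmem

/-! ### `L_p` norms of continuous functions -/

variable {p : ℝ≥0∞} [Fact (1 ≤ p)]

theorem norm_toLp_comp_mul_left (h : C(Torus, X)) (η : Torus) :
    ‖ContinuousMap.toLp p haar ℂ (h.comp ⟨fun ω => η * ω, by fun_prop⟩)‖ =
      ‖ContinuousMap.toLp p haar ℂ h‖ := by
  rw [Lp.norm_def, Lp.norm_def, eLpNorm_congr_ae (ContinuousMap.coeFn_toLp haar _),
    eLpNorm_congr_ae (ContinuousMap.coeFn_toLp haar _)]
  exact congrArg _ (eLpNorm_comp_measurePreserving h.continuous.aestronglyMeasurable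
    (measurePreserving_mul_left haar η))

/-- Haar measure charges nonempty open sets, so an almost everywhere bound on a continuous function
holds everywhere. -/
theorem norm_toLp_top (h : C(Torus, X)) : ‖ContinuousMap.toLp ∞ haar ℂ h‖ = ‖h‖ := by
  refine le_antisymm ?_ ?_
  · rw [Lp.norm_def, eLpNorm_congr_ae (ContinuousMap.coeFn_toLp haar _), eLpNorm_exponent_top]
    refine ENNReal.toReal_le_of_le_ofReal (norm_nonneg _) ?_
    exact eLpNormEssSup_le_of_ae_bound (.of_forall h.norm_coe_le_norm)
  · rw [ContinuousMap.norm_le _ (norm_nonneg _)]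
    have h1 : ∀ᵐ ω ∂haar, ‖h ω‖ ≤ ‖ContinuousMap.toLp ∞ haar ℂ h‖ := by
      have hf := Lp.eLpNorm_ne_top (ContinuousMap.toLp ∞ haar ℂ h)
      rw [Lp.norm_def]
      rw [eLpNorm_exponent_top] at hf ⊢
      filter_upwards [ae_le_eLpNormEssSup (f := ContinuousMap.toLp ∞ haar ℂ h) (μ := haar),
        ContinuousMap.coeFn_toLp (p := ∞) (𝕜 := ℂ) haar h] with ω h1 h2
      rw [h2] at h1
      simpa using ENNReal.toReal_mono hf h1
    have h2 := (Measure.dense_of_ae h1).closure_eq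
    rw [(isClosed_le (by fun_prop) continuous_const).closure_eq] at h2
    exact fun ω => (h2 ▸ Set.mem_univ ω : ω ∈ {ω | ‖h ω‖ ≤ _})

theorem norm_toLp_tensor (α : ℕ →₀ ℤ) (x : X) :
    ‖ContinuousMap.toLp p haar ℂ (tensor α x)‖ = ‖x‖ := by
  have hp : p ≠ 0 := (zero_lt_one.trans_le (Fact.out : 1 ≤ p)).ne'
  rw [Lp.norm_def, eLpNorm_congr_ae (ContinuousMap.coeFn_toLp haar _),
    eLpNorm_congr_norm_ae (g := fun _ => x) (.of_forall fun ω => by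
      simp only [tensor, ContinuousMap.coe_mk, norm_smul, norm_mono, one_mul]),
    eLpNorm_const _ hp (IsProbabilityMeasure.ne_zero _)]
  simp

end

/-! ### The norm in `L_q(𝕋^ℕ, X^*)` by duality, for continuous functions -/

section

variable {X : Type*} [NormedAddCommGroup X] [NormedSpace ℂ X]

theorem exists_norm_le_one_lt_re_apply (f : StrongDual ℂ X) {δ : ℝ} (hδ : 0 < δ) :
    ∃ x : X, ‖x‖ ≤ 1 ∧ ‖f‖ - δ < (f x).re := by
  rcases le_or_gt ‖f‖ 0 with h | h
  · exact ⟨0, by simp, by simp; linarith⟩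
  · obtain ⟨x, hx, hfx⟩ := f.exists_lt_apply_of_lt_opNorm (sub_lt_self ‖f‖ hδ)
    obtain ⟨c, hc, hcx⟩ := RCLike.exists_norm_eq_mul_self (f x)
    refine ⟨c • x, by rw [norm_smul, hc, one_mul]; exact hx.le, ?_⟩
    rw [map_smul, smul_eq_mul, ← hcx]
    simpa using hfx

/-- A continuous choice of almost norming vectors. -/
theorem exists_continuousMap_norming {K : Type*} [TopologicalSpace K] [NormalSpace K]
    [ParacompactSpace K] (Q : C(K, StrongDual ℂ X)) {δ : ℝ} (hδ : 0 < δ) :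
    ∃ x : C(K, X), ∀ ω, ‖x ω‖ ≤ 1 ∧ ‖Q ω‖ - δ ≤ (Q ω (x ω)).re := by
  let : NormedSpace ℝ X := NormedSpace.restrictScalars ℝ ℂ X
  -- A vector almost norming for `Q ω` stays so for nearby points, and the admissible vectors form a
  -- convex set, so local constant choices glue.
  refine exists_continuous_forall_mem_convex_of_local_const
    (t := fun ω => {x : X | ‖x‖ ≤ 1 ∧ ‖Q ω‖ - δ ≤ (Q ω x).re}) (fun ω => ?_) fun ω => ?_
  · have h1 : Convex ℝ {x : X | ‖x‖ ≤ 1} := by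
      simpa [Metric.closedBall, dist_eq_norm] using! convex_closedBall (0 : X) 1
    exact h1.inter (convex_halfSpace_ge
      (Complex.reLm.comp ((Q ω : X →ₗ[ℂ] ℂ).restrictScalars ℝ)).isLinear _)
  · obtain ⟨x, hx, hQ⟩ := exists_norm_le_one_lt_re_apply (Q ω) hδ
    refine ⟨x, ?_⟩
    have hc : ContinuousAt (fun y => (Q y x).re - (‖Q y‖ - δ)) ω := by fun_prop
    filter_upwards [hc.eventually (lt_mem_nhds (sub_pos.mpr hQ))] with y hy
    exact ⟨hx, (sub_pos.mp hy).le⟩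

variable {p q : ℝ≥0∞} [Fact (1 ≤ p)] [Fact (1 ≤ q)]

theorem norm_toLp_eq_integral {Y : Type*} [NormedAddCommGroup Y] {𝕜 : Type*} [RCLike 𝕜]
    [NormedSpace 𝕜 Y] (hp : p ≠ ∞) (h : C(Torus, Y)) :
    ‖ContinuousMap.toLp p haar 𝕜 h‖ = (∫ ω, ‖h ω‖ ^ p.toReal ∂haar) ^ p.toReal⁻¹ := by
  have hp0 : p ≠ 0 := (zero_lt_one.trans_le (Fact.out : 1 ≤ p)).ne'
  rw [Lp.norm_def, (Lp.memLp _).eLpNorm_eq_integral_rpow_norm hp0 hp, ENNReal.toReal_ofReal]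
  · congr 1
    refine integral_congr_ae ?_
    filter_upwards [ContinuousMap.coeFn_toLp (p := p) (𝕜 := 𝕜) haar h] with ω hω
    rw [hω]
  · exact Real.rpow_nonneg (integral_nonneg fun ω => by positivity) _

theorem integrable_continuousMap {Y : Type*} [NormedAddCommGroup Y] (h : C(Torus, Y)) :
    Integrable h haar :=
  h.continuous.integrable_of_hasCompactSupport (HasCompactSupport.of_compactSpace _)

/-- Test with `h = ψ · x`, where `x` is a continuous almost norming selection for `Q`. The
vector-valued duality is thereby reduced to the scalar one for `‖Q‖`. -/
theorem integral_mul_norm_le_of_pairing_le (Q : C(Torus, StrongDual ℂ X)) {C : ℝ} (hC : 0 ≤ C)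
    (H : ∀ h : C(Torus, X), ‖∫ ω, Q ω (h ω) ∂haar‖ ≤ C * ‖ContinuousMap.toLp p haar ℂ h‖)
    (ψ : C(Torus, ℝ)) (hψ : ∀ ω, 0 ≤ ψ ω) :
    ∫ ω, ψ ω * ‖Q ω‖ ∂haar ≤ C * ‖ContinuousMap.toLp p haar ℝ ψ‖ := by
  refine le_of_forall_pos_le_add fun η hη => ?_
  have hI : 0 ≤ ∫ ω, ψ ω ∂haar := integral_nonneg hψ
  -- Chosen so that the total loss `δ ∫ ψ` is at most `η`; the summand `1` keeps the denominator
  -- positive.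
  set δ := η / (1 + ∫ ω, ψ ω ∂haar) with hδ_def
  have hδ : 0 < δ := by positivity
  obtain ⟨x, hx⟩ := exists_continuousMap_norming Q hδ
  set h : C(Torus, X) := ⟨fun ω => (ψ ω : ℂ) • x ω, by fun_prop⟩
  have hnorm : ‖ContinuousMap.toLp p haar ℂ h‖ ≤ ‖ContinuousMap.toLp p haar ℝ ψ‖ := by
    rw [Lp.norm_def, Lp.norm_def, eLpNorm_congr_ae (ContinuousMap.coeFn_toLp haar _)]
    refine ENNReal.toReal_mono (Lp.eLpNorm_ne_top _) ?_
    rw [eLpNorm_congr_ae (ContinuousMap.coeFn_toLp haar ψ)]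
    refine eLpNorm_mono fun ω => ?_
    simp only [h, ContinuousMap.coe_mk, norm_smul, Complex.norm_real]
    exact mul_le_of_le_one_right (norm_nonneg _) (hx ω).1
  have hQh : Integrable (fun ω => Q ω (h ω)) haar :=
    integrable_continuousMap ⟨fun ω => Q ω (h ω), by fun_prop⟩
  have hψδ : Integrable (fun ω => ψ ω * (‖Q ω‖ - δ)) haar :=
    integrable_continuousMap ⟨fun ω => ψ ω * (‖Q ω‖ - δ), by fun_prop⟩
  have hψQ : Integrable (fun ω => ψ ω * ‖Q ω‖) haar :=
    integrable_continuousMap ⟨fun ω => ψ ω * ‖Q ω‖, by fun_prop⟩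
  have h1 : ∫ ω, ψ ω * (‖Q ω‖ - δ) ∂haar ≤ ∫ ω, (Q ω (h ω)).re ∂haar := by
    refine integral_mono hψδ hQh.re fun ω => ?_
    simp only [h, ContinuousMap.coe_mk, map_smul, smul_eq_mul, Complex.re_ofReal_mul]
    exact mul_le_mul_of_nonneg_left (hx ω).2 (hψ ω)
  have h2 : ∫ ω, (Q ω (h ω)).re ∂haar ≤ ‖∫ ω, Q ω (h ω) ∂haar‖ := by
    have := integral_re hQh
    simp only [RCLike.re_to_complex] at this
    rw [this]
    exact Complex.re_le_norm _
  have h3 : ∫ ω, ψ ω * (‖Q ω‖ - δ) ∂haar = ∫ ω, ψ ω * ‖Q ω‖ ∂haar - (∫ ω, ψ ω ∂haar) * δ := by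
    rw [← integral_mul_const, ← integral_sub hψQ
      ((integrable_continuousMap ψ).mul_const δ)]
    simp only [mul_sub]
  have h4 : (∫ ω, ψ ω ∂haar) * δ ≤ η := by
    rw [hδ_def, mul_div_assoc', div_le_iff₀ (by positivity)]
    nlinarith
  have h5 := mul_le_mul_of_nonneg_left hnorm hC
  linarith [H h]

theorem norm_toLp_le_of_pairing_le (hpq : p⁻¹ + q⁻¹ = 1) (Q : C(Torus, StrongDual ℂ X)) {C : ℝ}
    (hC : 0 ≤ C)
    (H : ∀ h : C(Torus, X), ‖∫ ω, Q ω (h ω) ∂haar‖ ≤ C * ‖ContinuousMap.toLp p haar ℂ h‖) :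
    ‖ContinuousMap.toLp q haar ℂ Q‖ ≤ C := by
  have hconj : p.HolderConjugate q := ENNReal.holderConjugate_iff.mpr hpq
  have key := integral_mul_norm_le_of_pairing_le Q hC H
  rcases eq_or_ne p ∞ with rfl | hp
  · have hq : q = 1 := by simpa using hpq
    subst hq
    have h1 := key 1 fun _ => zero_le_one
    have h2 : ‖ContinuousMap.toLp ∞ haar ℝ (1 : C(Torus, ℝ))‖ ≤ 1 := by
      rw [Lp.norm_def, eLpNorm_congr_ae (ContinuousMap.coeFn_toLp haar _), eLpNorm_exponent_top]
      exact ENNReal.toReal_le_of_le_ofReal zero_le_one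
        (eLpNormEssSup_le_of_ae_bound (.of_forall fun ω => by simp))
    rw [norm_toLp_eq_integral (by simp)]
    simp only [ContinuousMap.one_apply, one_mul] at h1
    simp only [ENNReal.toReal_one, Real.rpow_one, inv_one]
    exact h1.trans (mul_le_of_le_one_right hC h2)
  rcases eq_or_ne q ∞ with rfl | hq
  · have hp1 : p = 1 := by simpa using hpq
    subst hp1
    -- The excess of `‖Q‖` over `C`: since `ψ² = ψ‖Q‖ - Cψ`, testing with `ψ` forces `∫ ψ² ≤ 0`.
    set ψ : C(Torus, ℝ) := ⟨fun ω => max (‖Q ω‖ - C) 0, by fun_prop⟩ with hψ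
    have h0 : ∀ ω, 0 ≤ ψ ω := fun ω => le_max_right _ _
    have h1 := key ψ h0
    rw [norm_toLp_eq_integral (by simp)] at h1
    simp only [ENNReal.toReal_one, Real.rpow_one, inv_one, Real.norm_of_nonneg (h0 _)] at h1
    have h2 : ∫ ω, ψ ω * ψ ω ∂haar ≤ 0 := by
      have h3 : ∀ ω, ψ ω * ψ ω = ψ ω * ‖Q ω‖ - C * ψ ω := fun ω => by
        simp only [hψ, ContinuousMap.coe_mk]
        rcases le_total (‖Q ω‖ - C) 0 with h | h
        · simp [max_eq_right h]
        · rw [max_eq_left h]; ring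
      have hψQ : Integrable (fun ω => ψ ω * ‖Q ω‖) haar :=
        integrable_continuousMap ⟨fun ω => ψ ω * ‖Q ω‖, by fun_prop⟩
      simp only [h3]
      rw [integral_sub hψQ
        ((integrable_continuousMap ψ).const_mul C), integral_const_mul]
      linarith
    have h3 : (fun ω => ψ ω * ψ ω) =ᵐ[haar] 0 :=
      (integral_eq_zero_iff_of_nonneg (fun ω => mul_self_nonneg _)
        (integrable_continuousMap (ψ * ψ))).mp
        (le_antisymm h2 (integral_nonneg fun ω => mul_self_nonneg _))
    rw [Lp.norm_def, eLpNorm_congr_ae (ContinuousMap.coeFn_toLp haar _), eLpNorm_exponent_top]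
    refine ENNReal.toReal_le_of_le_ofReal hC (eLpNormEssSup_le_of_ae_bound ?_)
    filter_upwards [h3] with ω hω
    have : ψ ω = 0 := mul_self_eq_zero.mp hω
    have := le_max_left (‖Q ω‖ - C) 0
    simp only [hψ, ContinuousMap.coe_mk] at *
    linarith
  · have hr : p.toReal.HolderConjugate q.toReal :=
      ENNReal.HolderTriple.toReal 1
        (ENNReal.toReal_pos (zero_lt_one.trans_le (Fact.out : 1 ≤ p)).ne' hp)
        (ENNReal.toReal_pos (zero_lt_one.trans_le (Fact.out : 1 ≤ q)).ne' hq)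
    set a := ∫ ω, ‖Q ω‖ ^ q.toReal ∂haar with ha
    have ha0 : 0 ≤ a := integral_nonneg fun ω => by positivity
    have hq1 : 0 < q.toReal - 1 := sub_pos.mpr hr.symm.lt
    -- The extremal function in Hölder's inequality: both `ψ‖Q‖` and `ψ^p` equal `‖Q‖^q`, so the
    -- test reads `a ≤ C a^{1/p}`.
    set ψ : C(Torus, ℝ) := ⟨fun ω => ‖Q ω‖ ^ (q.toReal - 1),
      (Real.continuous_rpow_const hq1.le).comp Q.continuous.norm⟩ with hψ
    have h0 : ∀ ω, 0 ≤ ψ ω := fun ω => by simp only [hψ, ContinuousMap.coe_mk]; positivity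
    have h1 := key ψ h0
    have e1 : ∀ ω, ψ ω * ‖Q ω‖ = ‖Q ω‖ ^ q.toReal := fun ω => by
      simp only [hψ, ContinuousMap.coe_mk]
      nth_rewrite 2 [← Real.rpow_one ‖Q ω‖]
      rw [← Real.rpow_add_of_nonneg (norm_nonneg _) hq1.le zero_le_one, sub_add_cancel]
    have e2 : ∀ ω, ψ ω ^ p.toReal = ‖Q ω‖ ^ q.toReal := fun ω => by
      simp only [hψ, ContinuousMap.coe_mk]
      rw [← Real.rpow_mul (norm_nonneg _), hr.symm.sub_one_mul_conj]
    rw [norm_toLp_eq_integral hp] at h1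
    simp only [Real.norm_of_nonneg (h0 _), e1, e2, ← ha] at h1
    rw [norm_toLp_eq_integral hq, ← ha]
    rcases ha0.eq_or_lt with h | h
    · rw [← h, Real.zero_rpow (inv_ne_zero hr.symm.ne_zero)]
      exact hC
    · have e3 : a ^ q.toReal⁻¹ * a ^ p.toReal⁻¹ = a := by
        rw [← Real.rpow_add h, add_comm, hr.inv_add_inv_eq_one, Real.rpow_one]
      have h4 : 0 < a ^ p.toReal⁻¹ := by positivity
      exact le_of_mul_le_mul_right (e3.le.trans h1) h4

end

/-! ### The duality pairing -/

section

variable {X : Type*} [NormedAddCommGroup X] [NormedSpace ℂ X]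

/-- The linear functional `∑ c_α ω^α ↦ ∑ b_α(c_α)` on trigonometric polynomials. -/
noncomputable def dualForm (b : (ℕ →₀ ℤ) → StrongDual ℂ X) : ((ℕ →₀ ℤ) →₀ X) →ₗ[ℂ] ℂ :=
  Finsupp.lsum ℂ fun α => (b α : X →ₗ[ℂ] ℂ)

theorem dualForm_apply (b : (ℕ →₀ ℤ) → StrongDual ℂ X) (c : (ℕ →₀ ℤ) →₀ X) :
    dualForm b c = ∑ α ∈ c.support, b α (c α) := by
  rw [dualForm, Finsupp.coe_lsum]
  rfl

theorem dualForm_single (b : (ℕ →₀ ℤ) → StrongDual ℂ X) (α : ℕ →₀ ℤ) (x : X) :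
    dualForm b (Finsupp.single α x) = b α x := by
  rw [dualForm, Finsupp.lsum_single]
  rfl

/-- The form is a finite sum, so it commutes with averaging the multiplier. It is used for kernels
on `ℝ` and for the Gaussian measure. -/
theorem norm_dualForm_le_of_integral {T : Type*} [MeasurableSpace T] {ν : Measure T}
    (b : (ℕ →₀ ℤ) → StrongDual ℂ X) (c : (ℕ →₀ ℤ) →₀ X) {φ : (ℕ →₀ ℤ) → ℂ}
    {Φ : T → (ℕ →₀ ℤ) → ℂ} {g : T → ℝ} (hg : Integrable g ν)
    (hi : ∀ α, Integrable (fun t => Φ t α) ν) (hφ : ∀ α, ∫ t, Φ t α ∂ν = φ α)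
    (hΦ : ∀ t, ‖dualForm (fun α => Φ t α • b α) c‖ ≤ g t) :
    ‖dualForm (fun α => φ α • b α) c‖ ≤ ∫ t, g t ∂ν := by
  have h : dualForm (fun α => φ α • b α) c = ∫ t, dualForm (fun α => Φ t α • b α) c ∂ν := by
    simp only [dualForm_apply, smul_apply, smul_eq_mul]
    rw [integral_finsetSum _ fun α _ => (hi α).mul_const _]
    simp only [integral_mul_const, hφ]
  rw [h]
  exact norm_integral_le_of_norm_le hg (.of_forall hΦ)

theorem dualForm_sub_smul (b : (ℕ →₀ ℤ) → StrongDual ℂ X) (c : (ℕ →₀ ℤ) →₀ X)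
    (φ ψ : (ℕ →₀ ℤ) → ℂ) : dualForm (fun α => (φ α - ψ α) • b α) c =
      dualForm (fun α => φ α • b α) c - dualForm (fun α => ψ α • b α) c := by
  simp only [dualForm_apply, smul_apply, sub_smul, Finset.sum_sub_distrib]

/-- The pairing `(g, h) ↦ ∫ g(ω)(h(ω)) dω` of `L_q(𝕋^ℕ, X^*)` and `L_p(𝕋^ℕ, X)`. -/
noncomputable def pairing (q p : ℝ≥0∞) [Fact (1 ≤ q)] [Fact (1 ≤ p)] [q.HolderConjugate p]
    (X : Type*) [NormedAddCommGroup X] [NormedSpace ℂ X] :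
    Lp (StrongDual ℂ X) q haar →L[ℂ] Lp X p haar →L[ℂ] ℂ :=
  (ContinuousLinearMap.id ℂ (StrongDual ℂ X)).lpPairing haar q p

variable {p q : ℝ≥0∞} [Fact (1 ≤ p)] [Fact (1 ≤ q)] [q.HolderConjugate p]

theorem norm_pairing_apply_le (G : Lp (StrongDual ℂ X) q haar) (h : Lp X p haar) :
    ‖pairing q p X G h‖ ≤ ‖G‖ * ‖h‖ := by
  rw [pairing, ContinuousLinearMap.lpPairing_eq_integral]
  refine (norm_integral_le_integral_norm _).trans ?_
  have h1 : ∫ ω, ‖(ContinuousLinearMap.id ℂ (StrongDual ℂ X)) (G ω) (h ω)‖ ∂haar =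
      ‖(ContinuousLinearMap.id ℂ (StrongDual ℂ X)).holder 1 G h‖ := by
    rw [L1.norm_eq_integral_norm]
    refine integral_congr_ae ?_
    filter_upwards [(ContinuousLinearMap.id ℂ (StrongDual ℂ X)).coeFn_holder (r := 1) G h] with ω h
    rw [h]
  rw [h1]
  refine (ContinuousLinearMap.norm_holder_apply_apply_le _ _ _).trans ?_
  rw [mul_assoc]
  exact mul_le_of_le_one_left (by positivity) ContinuousLinearMap.norm_id_le

theorem pairing_toLp (Q : C(Torus, StrongDual ℂ X)) (h : C(Torus, X)) :
    pairing q p X (ContinuousMap.toLp q haar ℂ Q) (ContinuousMap.toLp p haar ℂ h) =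
      ∫ ω, Q ω (h ω) ∂haar := by
  rw [pairing, ContinuousLinearMap.lpPairing_eq_integral]
  refine integral_congr_ae ?_
  filter_upwards [ContinuousMap.coeFn_toLp (p := q) (𝕜 := ℂ) haar Q,
    ContinuousMap.coeFn_toLp (p := p) (𝕜 := ℂ) haar h] with ω h1 h2
  rw [h1, h2]
  rfl

theorem pairing_tensor (G : Lp (StrongDual ℂ X) q haar) (α : ℕ →₀ ℤ) (x : X) :
    pairing q p X G (ContinuousMap.toLp p haar ℂ (tensor α x)) = fourierCoeff G (-α) x := by
  rw [pairing, ContinuousLinearMap.lpPairing_eq_integral, fourierCoeff, neg_neg,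
    ContinuousLinearMap.integral_apply (integrable_smul (integrable_Lp G) _)]
  refine integral_congr_ae ?_
  filter_upwards [ContinuousMap.coeFn_toLp (p := p) (𝕜 := ℂ) haar (tensor α x)] with ω h
  rw [h]
  simp [tensor]

theorem pairing_trigPolynomial (G : Lp (StrongDual ℂ X) q haar) (c : (ℕ →₀ ℤ) →₀ X) :
    pairing q p X G (ContinuousMap.toLp p haar ℂ (trigPolynomial X c)) =
      dualForm (fun α => fourierCoeff G (-α)) c := by
  rw [trigPolynomial_apply, Finsupp.sum, map_sum, map_sum, dualForm_apply]
  exact Finset.sum_congr rfl fun α _ => pairing_tensor G α _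

/-- Both sides of the duality test are continuous in `h`, so trigonometric polynomials suffice, and
on them the pairing involves only Fourier coefficients. -/
theorem norm_toLp_le_of_dualForm_le {b : (ℕ →₀ ℤ) → StrongDual ℂ X} (Q : C(Torus, StrongDual ℂ X))
    (hQ : ∀ α, fourierCoeff (ContinuousMap.toLp q haar ℂ Q) α = b (-α)) {C : ℝ} (hC : 0 ≤ C)
    (hb : ∀ c, ‖dualForm b c‖ ≤ C * ‖ContinuousMap.toLp p haar ℂ (trigPolynomial X c)‖) :
    ‖ContinuousMap.toLp q haar ℂ Q‖ ≤ C := by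
  have hpq : p.HolderConjugate q := .symm
  refine norm_toLp_le_of_pairing_le (p := p) (ENNReal.holderConjugate_iff.mp hpq) Q hC fun h => ?_
  rw [← pairing_toLp (p := p) (q := q)]
  refine denseRange_trigPolynomial.induction_on h
    (isClosed_le (by fun_prop) (by fun_prop)) fun c => ?_
  rw [pairing_trigPolynomial]
  simpa only [hQ, neg_neg] using hb c

/-! ### Functionals on `E_p(𝕋^ℕ, X)` -/

/-- The elementary tensor `ω^α ⊗ x` as a function of `x`. -/
noncomputable def tensorL (X : Type*) [NormedAddCommGroup X] [NormedSpace ℂ X] (α : ℕ →₀ ℤ) :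
    X →L[ℂ] C(Torus, X) :=
  LinearMap.mkContinuous
    { toFun := tensor α
      map_add' := fun x y => by ext ω; simp [tensor]
      map_smul' := fun c x => by ext ω; simp [tensor, smul_comm c] } 1 fun x => by
    rw [one_mul, ContinuousMap.norm_le _ (norm_nonneg x)]
    intro ω
    simp [tensor, norm_smul, norm_mono]

variable {E : Type*} [NormedAddCommGroup E] [NormedSpace ℂ E] (ι : C(Torus, X) →L[ℂ] E)
  (f : StrongDual ℂ E)

/-- The functional `x ↦ f(ω^α ⊗ x)`. -/
noncomputable def coeffDual (α : ℕ →₀ ℤ) : StrongDual ℂ X := f ∘L ι ∘L tensorL X α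

theorem coeffDual_apply (α : ℕ →₀ ℤ) (x : X) : coeffDual ι f α x = f (ι (tensor α x)) := rfl

theorem dualForm_coeffDual (c : (ℕ →₀ ℤ) →₀ X) :
    dualForm (coeffDual ι f) c = f (ι (trigPolynomial X c)) := by
  rw [dualForm_apply, trigPolynomial_apply, Finsupp.sum, map_sum, map_sum]
  rfl

variable {ι}

theorem norm_coeffDual_le (hn : ∀ h, ‖ι h‖ = ‖ContinuousMap.toLp p haar ℂ h‖)
    (α : ℕ →₀ ℤ) : ‖coeffDual ι f α‖ ≤ ‖f‖ := by
  refine ContinuousLinearMap.opNorm_le_bound _ (norm_nonneg f) fun x => ?_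
  rw [coeffDual_apply]
  refine (f.le_opNorm _).trans (le_of_eq ?_)
  rw [hn, norm_toLp_tensor]

/-- The multiplier `e^{itL}` is translation of the argument by `flow t`, an isometry for the `L_p`
norm. -/
theorem norm_dualForm_flow_le (hn : ∀ h, ‖ι h‖ = ‖ContinuousMap.toLp p haar ℂ h‖)
    (c : (ℕ →₀ ℤ) →₀ X) (t : ℝ) :
    ‖dualForm (fun α => Complex.exp (t * logPrime α * Complex.I) • coeffDual ι f α) c‖ ≤
      ‖f‖ * ‖ι (trigPolynomial X c)‖ := by
  have h : dualForm (fun α => Complex.exp (t * logPrime α * Complex.I) • coeffDual ι f α) c =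
      f (ι ((trigPolynomial X c).comp ⟨fun ω => flow t * ω, by fun_prop⟩)) := by
    have h1 : (trigPolynomial X c).comp ⟨fun ω => flow t * ω, by fun_prop⟩ =
        ∑ α ∈ c.support, Complex.exp (t * logPrime α * Complex.I) • tensor α (c α) := by
      ext ω
      rw [trigPolynomial_apply, Finsupp.sum]
      simp [tensor, mono_mul_apply, mono_flow, mul_smul, ContinuousMap.sum_apply]
    rw [h1, dualForm_apply, map_sum, map_sum]
    refine Finset.sum_congr rfl fun α _ => ?_
    rw [map_smul, map_smul]
    rfl
  rw [h]
  refine (f.le_opNorm _).trans (le_of_eq ?_)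
  rw [hn, hn, norm_toLp_comp_mul_left]

theorem norm_dualForm_le_of_kernel (hn : ∀ h, ‖ι h‖ = ‖ContinuousMap.toLp p haar ℂ h‖)
    {k : ℝ → ℝ} (hk : Integrable k) {φ : (ℕ →₀ ℤ) → ℂ}
    (hφ : ∀ α, ∫ t, (k t : ℂ) * Complex.exp (t * logPrime α * Complex.I) = φ α)
    (c : (ℕ →₀ ℤ) →₀ X) :
    ‖dualForm (fun α => φ α • coeffDual ι f α) c‖ ≤
      (∫ t, |k t|) * (‖f‖ * ‖ι (trigPolynomial X c)‖) := by
  rw [← integral_mul_const]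
  refine norm_dualForm_le_of_integral (coeffDual ι f) c (hk.abs.mul_const _)
    (fun α => integrable_mul_exp hk _) hφ fun t => ?_
  have h2 : dualForm (fun α => ((k t : ℂ) * Complex.exp (t * logPrime α * Complex.I)) •
      coeffDual ι f α) c = (k t : ℂ) •
      dualForm (fun α => Complex.exp (t * logPrime α * Complex.I) • coeffDual ι f α) c := by
    simp only [dualForm_apply, Finset.smul_sum, mul_smul, smul_apply]
  rw [h2, norm_smul, Complex.norm_real, Real.norm_eq_abs]
  exact mul_le_mul_of_nonneg_left (norm_dualForm_flow_le f hn c t) (abs_nonneg _)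

open ProbabilityTheory in
-- The kernel is a probability density, hence the constant is exactly `‖f‖`; the isometry rests on
-- this.
theorem norm_dualForm_cauchy_le (hn : ∀ h, ‖ι h‖ = ‖ContinuousMap.toLp p haar ℂ h‖)
    {ε : NNReal} (hε : ε ≠ 0) (c : (ℕ →₀ ℤ) →₀ X) :
    ‖dualForm (fun α => Complex.exp (-(ε * |logPrime α| : ℝ)) • coeffDual ι f α) c‖ ≤
      ‖f‖ * ‖ι (trigPolynomial X c)‖ := by
  refine (norm_dualForm_le_of_kernel f hn (integrable_cauchyPDFReal 0 (γ := ε))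
    (fun α => integral_exp_mul_cauchyPDFReal hε _) c).trans (le_of_eq ?_)
  simp only [abs_of_pos (cauchyPDF_pos 0 hε _)]
  rw [integral_cauchyPDFReal_eq_one 0 hε, one_mul]

open ProbabilityTheory in
-- This multiplier comes from the kernel `P_ε - P_ε(· - h)`, with `P_ε` the Cauchy density.
theorem norm_dualForm_cauchy_sub_shift_le (hn : ∀ h, ‖ι h‖ = ‖ContinuousMap.toLp p haar ℂ h‖)
    {ε : NNReal} (hε : ε ≠ 0) (h : ℝ) (c : (ℕ →₀ ℤ) →₀ X) :
    ‖dualForm (fun α => (Complex.exp (-(ε * |logPrime α| : ℝ)) *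
      (1 - Complex.exp (h * logPrime α * Complex.I))) • coeffDual ι f α) c‖ ≤
      |h| / ε * (‖f‖ * ‖ι (trigPolynomial X c)‖) := by
  have hP := integrable_cauchyPDFReal 0 (γ := ε)
  refine (norm_dualForm_le_of_kernel f hn (hP.sub (hP.comp_sub_right h)) (fun α => ?_) c).trans
    (mul_le_mul_of_nonneg_right (integral_abs_cauchyPDFReal_sub_le hε h) (by positivity))
  let K : ℝ → ℂ := fun t => (cauchyPDFReal 0 ε t : ℂ) *
    Complex.exp (t * logPrime α * Complex.I) * Complex.exp (h * logPrime α * Complex.I)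
  have e : ∀ t : ℝ, (cauchyPDFReal 0 ε (t - h) : ℂ) * Complex.exp (t * logPrime α * Complex.I) =
      K (t - h) := fun t => by
    simp only [K, mul_assoc, ← Complex.exp_add]
    push_cast
    ring_nf
  simp only [Pi.sub_apply, Complex.ofReal_sub, sub_mul]
  rw [integral_sub (integrable_mul_exp hP _) (integrable_mul_exp (hP.comp_sub_right h) _)]
  simp only [e]
  rw [integral_sub_right_eq_self K h, integral_mul_const,
    integral_exp_mul_cauchyPDFReal hε]
  ring

open ProbabilityTheory in
-- Average the shift estimate over `h = δs` with `s` standard normal: `e^{iδsL}` has mean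
-- `e^{-δ²L²/2}`, and `|h|/ε` has mean `δ E|s|/ε`.
theorem norm_dualForm_cauchy_sub_gaussian_le (hn : ∀ h, ‖ι h‖ = ‖ContinuousMap.toLp p haar ℂ h‖)
    {ε : NNReal} (hε : ε ≠ 0) {δ : ℝ} (hδ : 0 ≤ δ) (c : (ℕ →₀ ℤ) →₀ X) :
    ‖dualForm (fun α => (Complex.exp (-(ε * |logPrime α| : ℝ)) *
      (1 - Complex.exp (-(δ ^ 2 * logPrime α ^ 2 / 2 : ℝ)))) • coeffDual ι f α) c‖ ≤
      δ * ((∫ s, |s| ∂gaussianReal 0 1) / ε * ‖f‖) * ‖ι (trigPolynomial X c)‖ := by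
  have hs : Integrable (fun s : ℝ => s) (gaussianReal 0 1) :=
    memLp_one_iff_integrable.mp (memLp_id_gaussianReal' 1 (by simp))
  have hi : ∀ L : ℝ, Integrable (fun s : ℝ => Complex.exp (δ * s * L * Complex.I))
      (gaussianReal 0 1) := fun L => by
    refine Integrable.of_bound (Continuous.aestronglyMeasurable (by fun_prop)) 1
      (.of_forall fun s => ?_)
    rw [← Complex.ofReal_mul, ← Complex.ofReal_mul, Complex.norm_exp_ofReal_mul_I]
  refine (norm_dualForm_le_of_integral (ν := gaussianReal 0 1) (coeffDual ι f) c
    (g := fun s => |s| * (δ * (ε : ℝ)⁻¹ * (‖f‖ * ‖ι (trigPolynomial X c)‖)))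
    (Φ := fun s α => Complex.exp (-(ε * |logPrime α| : ℝ)) *
      (1 - Complex.exp ((δ * s : ℝ) * logPrime α * Complex.I))) (hs.abs.mul_const _)
    (fun α => ?_) (fun α => ?_) fun s => ?_).trans (le_of_eq ?_)
  · simp only [Complex.ofReal_mul]
    exact ((integrable_const 1).sub (hi _)).const_mul _
  · simp only [Complex.ofReal_mul δ]
    rw [integral_const_mul, integral_sub (integrable_const 1) (hi _),
      integral_exp_mul_gaussianReal]
    simp
  · refine (norm_dualForm_cauchy_sub_shift_le f hn hε (δ * s) c).trans (le_of_eq ?_)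
    rw [abs_mul, abs_of_nonneg hδ]
    ring
  · rw [integral_mul_const]
    ring

end

/-! ### Functionals of analytic type give elements of `𝓗_q⁺(X^*)` -/

section

/-- With `u = log n`, completing the square gives `-δ²u²/2 ≤ 2/δ² - 2u`, so the terms are dominated
by a constant times `n^{-2}`. The Cauchy factor alone would give only `n^{-ε}`. -/
theorem summable_cauchy_mul_gaussian {ε : NNReal} {δ : ℝ} (hδ : 0 < δ) :
    Summable fun α : ℕ →₀ ℕ => ‖Complex.exp (-(ε * |logPrime (-toInt α)| : ℝ)) *
      Complex.exp (-(δ ^ 2 * logPrime (-toInt α) ^ 2 / 2 : ℝ))‖ := by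
  have hs : Summable fun n : ℕ+ => Real.exp (2 / δ ^ 2) * (1 / ((n : ℕ) : ℝ) ^ 2) :=
    ((Real.summable_one_div_nat_pow.mpr one_lt_two).comp_injective PNat.coe_injective).mul_left _
  refine Summable.of_nonneg_of_le (fun _ => norm_nonneg _) (fun α => ?_)
    ((Equiv.ofBijective primePow primePow_bijective).summable_iff.mpr hs)
  have hn : (0 : ℝ) < (primePow α : ℕ) := by exact_mod_cast (primePow α).pos
  rw [logPrime_neg, logPrime_toInt]
  change _ ≤ Real.exp (2 / δ ^ 2) * (1 / ((primePow α : ℕ) : ℝ) ^ 2)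
  set u := Real.log (primePow α : ℕ) with hu
  have e1 : 1 / ((primePow α : ℕ) : ℝ) ^ 2 = Real.exp (-(2 * u)) := by
    rw [Real.exp_neg, two_mul, Real.exp_add, hu, Real.exp_log hn, one_div, sq]
  rw [e1, ← Complex.exp_add, ← Real.exp_add, Complex.norm_exp]
  refine Real.exp_le_exp.mpr ?_
  simp only [← Complex.ofReal_neg, ← Complex.ofReal_add, Complex.ofReal_re]
  have h1 : 0 ≤ (ε : ℝ) * |(-u)| := by positivity
  have h2 : 2 / δ ^ 2 + -(2 * u) + δ ^ 2 * (-u) ^ 2 / 2 = (δ * u - 2 / δ) ^ 2 / 2 := by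
    field_simp
    ring
  have h3 : 0 ≤ (δ * u - 2 / δ) ^ 2 / 2 := by positivity
  linarith

theorem eq_toInt_of_nonneg {α : ℕ →₀ ℤ} (h : ¬∃ i, α i < 0) :
    α = toInt (α.mapRange Int.toNat rfl) := by
  push Not at h
  ext i
  simp [toInt, h i]

theorem toInt_injective : Function.Injective toInt :=
  Finsupp.mapRange_injective _ rfl Nat.cast_injective

/-! ### Continuous functions with prescribed Fourier coefficients -/

section

variable {Y : Type*} [NormedAddCommGroup Y] [NormedSpace ℂ Y]

theorem fourierCoeff_toLp {q : ℝ≥0∞} [Fact (1 ≤ q)] (Q : C(Torus, Y)) (α : ℕ →₀ ℤ) :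
    fourierCoeff (ContinuousMap.toLp q haar ℂ Q) α = fourierCoeff Q α := by
  refine integral_congr_ae ?_
  filter_upwards [ContinuousMap.coeFn_toLp (p := q) (𝕜 := ℂ) haar Q] with ω h
  rw [h]

/-- The Fourier coefficients as continuous linear maps on `C(𝕋^ℕ, Y)`. -/
noncomputable def fourierCoeffL (Y : Type*) [NormedAddCommGroup Y] [NormedSpace ℂ Y]
    (α : ℕ →₀ ℤ) : C(Torus, Y) →L[ℂ] Y :=
  LinearMap.mkContinuous
    { toFun := fun Q => fourierCoeff Q α
      map_add' := fun Q R => by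
        simp only [fourierCoeff, ContinuousMap.add_apply, smul_add]
        exact integral_add (integrable_smul (integrable_continuousMap Q) _)
          (integrable_smul (integrable_continuousMap R) _)
      map_smul' := fun c Q => by
        simp only [fourierCoeff, ContinuousMap.smul_apply, RingHom.id_apply]
        rw [← integral_smul]
        simp only [smul_comm c] } 1 fun Q => by
    rw [one_mul]
    refine (norm_integral_le_of_norm_le_const (C := ‖Q‖) (.of_forall fun ω => ?_)).trans ?_
    · rw [norm_smul, norm_mono, one_mul]
      exact Q.norm_coe_le_norm ω
    · simp

theorem fourierCoeff_tensor [CompleteSpace Y] (α β : ℕ →₀ ℤ) (y : Y) :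
    fourierCoeff (tensor β y) α = if β = α then y else 0 := by
  simp only [fourierCoeff, tensor, ContinuousMap.coe_mk, smul_smul]
  rw [integral_smul_const]
  have h : ∀ ω, mono (-α) ω * mono β ω = mono (-α + β) ω := fun ω => by
    rw [mono_add, ContinuousMap.mul_apply]
  simp only [h, integral_mono_eq_ite, neg_add_eq_zero, ite_smul, one_smul, zero_smul, eq_comm]

theorem exists_continuousMap_fourierCoeff_eq [CompleteSpace Y] {a : (ℕ →₀ ℤ) → Y}
    (ha : Summable fun α : ℕ →₀ ℕ => ‖a (toInt α)‖) (h0 : ∀ α, (∃ i, α i < 0) → a α = 0) :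
    ∃ Q : C(Torus, Y), ∀ α, fourierCoeff Q α = a α := by
  have hs : Summable fun α : ℕ →₀ ℕ => tensor (toInt α) (a (toInt α)) := by
    refine Summable.of_norm_bounded ha fun α => ?_
    rw [ContinuousMap.norm_le _ (norm_nonneg _)]
    intro ω
    simp [tensor, norm_smul, norm_mono]
  refine ⟨_, fun α => ((fourierCoeffL Y α).hasSum hs.hasSum).unique ?_⟩
  have he : ∀ β : ℕ →₀ ℕ, fourierCoeffL Y α (tensor (toInt β) (a (toInt β))) =
      if toInt β = α then a (toInt β) else 0 := fun β => fourierCoeff_tensor α (toInt β) _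
  simp only [he]
  by_cases hα : ∃ i, α i < 0
  · rw [h0 α hα]
    convert hasSum_zero with β
    rw [ite_eq_right_iff]
    rintro rfl
    exact h0 _ hα
  · have h1 := eq_toInt_of_nonneg hα
    have h2 := hasSum_ite_eq (α.mapRange Int.toNat rfl) (a α)
    convert h2 using 2 with β
    by_cases hβ : toInt β = α
    · have : β = α.mapRange Int.toNat rfl := toInt_injective (hβ.trans h1)
      rw [if_pos hβ, if_pos this, hβ]
    · have : β ≠ α.mapRange Int.toNat rfl := fun h => hβ (by rw [h, ← h1])
      rw [if_neg hβ, if_neg this]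

end

variable {X : Type*} [NormedAddCommGroup X] [NormedSpace ℂ X]
  {p q : ℝ≥0∞} [Fact (1 ≤ p)] [Fact (1 ≤ q)] [q.HolderConjugate p]
  {E : Type*} [NormedAddCommGroup E] [NormedSpace ℂ E] {ι : C(Torus, X) →L[ℂ] E}

/-- Evaluated at `x`, a Fourier coefficient is the pairing with the fixed tensor `ω^{-α} ⊗ x`, hence
continuous in `L_q`. -/
theorem tendsto_fourierCoeff_apply (p : ℝ≥0∞) [Fact (1 ≤ p)] [q.HolderConjugate p]
    {G : ℕ → Lp (StrongDual ℂ X) q haar}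
    {G' : Lp (StrongDual ℂ X) q haar} (hG : Filter.Tendsto G Filter.atTop (nhds G'))
    (α : ℕ →₀ ℤ) (x : X) :
    Filter.Tendsto (fun m => fourierCoeff (G m) α x) Filter.atTop
      (nhds (fourierCoeff G' α x)) := by
  have h := ((pairing q p X).flip (ContinuousMap.toLp p haar ℂ (tensor (-α) x))).continuous.tendsto
    G' |>.comp hG
  simpa only [Function.comp_def, ContinuousLinearMap.flip_apply, pairing_tensor, neg_neg] using h

open ProbabilityTheory in
-- The functional damped by `e^{-ε|L|}` is a function: it is the `L_q` limit of the continuous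
-- functions with the extra factor `e^{-δ²L²/2}`. Analyticity enters through summability, which
-- concerns only `ℕ₀^{(ℕ)}`.
theorem exists_Lp_fourierCoeff_eq (hn : ∀ h, ‖ι h‖ = ‖ContinuousMap.toLp p haar ℂ h‖)
    (f : StrongDual ℂ E) (hf : ∀ α x, (∃ i, α i < 0) → f (ι (tensor (-α) x)) = 0)
    {ε : NNReal} (hε : ε ≠ 0) :
    ∃ G : Lp (StrongDual ℂ X) q haar, ‖G‖ ≤ ‖f‖ ∧ ∀ α, fourierCoeff G α =
      Complex.exp (-(ε * |logPrime α| : ℝ)) • coeffDual ι f (-α) := by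
  set φ : (ℕ →₀ ℤ) → ℂ := fun α => Complex.exp (-(ε * |logPrime α| : ℝ)) with hφ
  set g : ℝ → (ℕ →₀ ℤ) → ℂ := fun δ α => Complex.exp (-(δ ^ 2 * logPrime α ^ 2 / 2 : ℝ)) with hg
  set M := (∫ s, |s| ∂gaussianReal 0 1) / ε * ‖f‖ with hM
  have hM0 : 0 ≤ M := by
    have : 0 ≤ ∫ s, |s| ∂gaussianReal 0 1 := integral_nonneg fun s => abs_nonneg s
    positivity
  let δ : ℕ → ℝ := fun m => 1 / ((m : ℝ) + 1)
  have hδ : ∀ m, 0 < δ m := fun m => by positivity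
  have hδ0 : Filter.Tendsto δ Filter.atTop (nhds 0) := tendsto_one_div_add_atTop_nhds_zero_nat
  have hQ : ∀ m, ∃ Q : C(Torus, StrongDual ℂ X), ∀ α, fourierCoeff Q α =
      (φ (-α) * g (δ m) (-α)) • coeffDual ι f (-α) := fun m => by
    refine exists_continuousMap_fourierCoeff_eq ?_ fun α hα => ?_
    · refine Summable.of_nonneg_of_le (fun _ => norm_nonneg _) (fun α => ?_)
        ((summable_cauchy_mul_gaussian (ε := ε) (hδ m)).mul_right ‖f‖)
      rw [norm_smul]
      exact mul_le_mul_of_nonneg_left (norm_coeffDual_le f hn _) (norm_nonneg _)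
    · have : coeffDual ι f (-α) = 0 := by
        ext x
        exact hf α x hα
      ext x
      simp [this]
  choose Q hQ using hQ
  have hdiff : ∀ (m : ℕ) c, ‖dualForm (fun α => (φ α * (1 - g (δ m) α)) • coeffDual ι f α) c‖ ≤
      δ m * M * ‖ι (trigPolynomial X c)‖ := fun m c =>
    norm_dualForm_cauchy_sub_gaussian_le f hn hε (hδ m).le c
  set G : ℕ → Lp (StrongDual ℂ X) q haar := fun m => ContinuousMap.toLp q haar ℂ (Q m) with hG
  -- Split the multiplier as `φ - φ(1 - g)`; the excess `δ m * M` vanishes in the limit.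
  have hnorm : ∀ m, ‖G m‖ ≤ ‖f‖ + δ m * M := fun m => by
    refine norm_toLp_le_of_dualForm_le (p := p) (Q m) (b := fun α => (φ α * g (δ m) α) •
      coeffDual ι f α) (fun α => by rw [fourierCoeff_toLp, hQ])
      (by have := hδ m; positivity) fun c => ?_
    have e : ∀ α, φ α * g (δ m) α = φ α - φ α * (1 - g (δ m) α) := fun α => by ring
    simp only [e]
    rw [dualForm_sub_smul, ← hn, add_mul]
    exact (norm_sub_le _ _).trans
      (add_le_add (norm_dualForm_cauchy_le f hn hε c) (hdiff m c))
  -- The multiplier `φ(g_m - g_k)` is the difference of two small ones, which makes the sequence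
  -- Cauchy.
  have hdist : ∀ m k, ‖G m - G k‖ ≤ (δ m + δ k) * M := fun m k => by
    rw [hG, ← map_sub]
    refine norm_toLp_le_of_dualForm_le (p := p) (Q m - Q k)
      (b := fun α => (φ α * (1 - g (δ k) α) - φ α * (1 - g (δ m) α)) • coeffDual ι f α)
      (fun α => ?_) (by have := hδ m; have := hδ k; positivity) fun c => ?_
    · rw [fourierCoeff_toLp]
      refine ((fourierCoeffL _ α).map_sub (Q m) (Q k)).trans ?_
      change fourierCoeff (Q m) α - fourierCoeff (Q k) α = _
      rw [hQ, hQ]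
      ext x
      simp only [sub_apply, smul_apply, smul_eq_mul]
      ring
    · rw [dualForm_sub_smul, ← hn, add_comm (δ m), add_mul, add_mul]
      exact (norm_sub_le _ _).trans (add_le_add (hdiff k c) (hdiff m c))
  have hcauchy : CauchySeq G := by
    refine cauchySeq_of_le_tendsto_0 (fun N => (δ N + δ N) * M) (fun m k N hm hk => ?_) ?_
    · rw [dist_eq_norm]
      refine (hdist m k).trans (mul_le_mul_of_nonneg_right (add_le_add ?_ ?_) hM0)
      · exact one_div_le_one_div_of_le (by positivity) (by gcongr)
      · exact one_div_le_one_div_of_le (by positivity) (by gcongr)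
    · simpa using (hδ0.add hδ0).mul_const M
  obtain ⟨G', hG'⟩ := cauchySeq_tendsto_of_complete hcauchy
  refine ⟨G', ?_, fun α => ?_⟩
  · refine le_of_tendsto_of_tendsto' hG'.norm ?_ hnorm
    simpa using (hδ0.mul_const M).const_add ‖f‖
  · ext x
    refine tendsto_nhds_unique (tendsto_fourierCoeff_apply p hG' α x) ?_
    have h1 : ∀ m, fourierCoeff (G m) α x =
        (φ (-α) * g (δ m) (-α)) * coeffDual ι f (-α) x := fun m => by
      rw [hG, fourierCoeff_toLp, hQ]
      rfl
    have h2 : φ (-α) = φ α := by simp only [hφ, logPrime_neg, abs_neg]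
    have h3 : Filter.Tendsto (fun m => g (δ m) (-α)) Filter.atTop (nhds 1) := by
      have hc : Continuous fun d => g d (-α) := by simp only [hg]; fun_prop
      have := (hc.tendsto 0).comp hδ0
      simpa [hg, Function.comp_def] using this
    simp only [h1, h2]
    have h4 := (h3.const_mul (φ α)).mul_const (coeffDual ι f (-α) x)
    rw [mul_one] at h4
    exact h4

end

/-! ### The isometry -/

section

theorem hardyBohr_primePow {q : ℝ≥0∞} [Fact (1 ≤ q)] {Y : Type*} [NormedAddCommGroup Y]
    [NormedSpace ℂ Y] (G : hardyTorus q Y) (α : ℕ →₀ ℕ) :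
    hardyBohr q Y G (primePow α) = fourierCoeff (G : Lp Y q haar) (toInt α) := by
  rw [hardyBohr, LinearMap.comp_apply, LinearEquiv.coe_coe, bohr_primePow]
  rfl

theorem norm_hardyBohr {q : ℝ≥0∞} [Fact (1 ≤ q)] {Y : Type*} [NormedAddCommGroup Y]
    [NormedSpace ℂ Y] [CompleteSpace Y] (G : hardyTorus q Y) :
    ‖(⟨hardyBohr q Y G, G, rfl⟩ : hardyDirichlet q Y)‖ = ‖(G : Lp Y q haar)‖ := by
  change ‖(hardyBohrEquiv q Y).symm (hardyBohrEquiv q Y G)‖ = _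
  rw [LinearEquiv.symm_apply_apply]
  rfl

/-- Here `log 𝔭^α ≥ 0`, so the two-sided Cauchy multiplier agrees with the translation `n^{-ε}`. -/
theorem one_div_primePow_cpow (α : ℕ →₀ ℕ) (ε : NNReal) :
    1 / ((primePow α : ℕ) : ℂ) ^ ((ε : ℝ) : ℂ) =
      Complex.exp (-(ε * |logPrime (toInt α)| : ℝ)) := by
  have h1 : (1 : ℝ) ≤ (primePow α : ℕ) := by exact_mod_cast (primePow α).pos
  have h0 : ((primePow α : ℕ) : ℂ) ≠ 0 := by exact_mod_cast (primePow α).ne_zero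
  rw [logPrime_toInt, abs_of_nonneg (Real.log_nonneg h1), Complex.cpow_def_of_ne_zero h0,
    one_div, ← Complex.exp_neg, ← Complex.natCast_log]
  congr 1
  push_cast
  ring

/-- The coefficients of a Dirichlet series, as a family indexed by `ℤ^{(ℕ)}`. -/
noncomputable def dirichletCoeff {Y : Type*} [Zero Y] (D : DirichletSeries Y) (α : ℕ →₀ ℤ) : Y :=
  open Classical in if ∃ i, α i < 0 then 0 else D (primePow (α.mapRange Int.toNat rfl))

theorem dirichletCoeff_toInt {Y : Type*} [Zero Y] (D : DirichletSeries Y) (α : ℕ →₀ ℕ) :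
    dirichletCoeff D (toInt α) = D (primePow α) := by
  have h : ¬∃ i, toInt α i < 0 := by simp [toInt]
  rw [dirichletCoeff, if_neg h, ← toInt_injective (eq_toInt_of_nonneg h)]

theorem dirichletCoeff_of_neg {Y : Type*} [Zero Y] (D : DirichletSeries Y) {α : ℕ →₀ ℤ}
    (h : ∃ i, α i < 0) : dirichletCoeff D α = 0 := if_pos h

theorem fourierCoeff_eq_of_hardyBohr_eq {q : ℝ≥0∞} [Fact (1 ≤ q)] {Y : Type*}
    [NormedAddCommGroup Y] [NormedSpace ℂ Y] {G : hardyTorus q Y} {D : DirichletSeries Y}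
    {ε : NNReal} (h : hardyBohr q Y G = translate ((ε : ℝ) : ℂ) D) (α : ℕ →₀ ℤ) :
    fourierCoeff (G : Lp Y q haar) α =
      Complex.exp (-(ε * |logPrime α| : ℝ)) • dirichletCoeff D α := by
  by_cases hα : ∃ i, α i < 0
  · rw [dirichletCoeff_of_neg D hα, smul_zero]
    exact G.2 α hα
  · obtain ⟨β, rfl⟩ : ∃ β, α = toInt β := ⟨_, eq_toInt_of_nonneg hα⟩
    rw [← hardyBohr_primePow, h, dirichletCoeff_toInt, ← one_div_primePow_cpow]
    rfl

variable {X : Type*} [NormedAddCommGroup X] [NormedSpace ℂ X]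
  {p q : ℝ≥0∞} [Fact (1 ≤ p)] [Fact (1 ≤ q)]

theorem norm_dualForm_dirichletCoeff_le [q.HolderConjugate p]
    (D : hardyPlus q (StrongDual ℂ X)) (c : (ℕ →₀ ℤ) →₀ X) :
    ‖dualForm (fun α => dirichletCoeff (D : DirichletSeries (StrongDual ℂ X)) (-α)) c‖ ≤
      ‖D‖ * ‖ContinuousMap.toLp p haar ℂ (trigPolynomial X c)‖ := by
  set b : (ℕ →₀ ℤ) → StrongDual ℂ X := fun α =>
    dirichletCoeff (D : DirichletSeries (StrongDual ℂ X)) (-α) with hb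
  -- After damping, the form is the pairing with the `L_q` function of `D_ε`, whose norm is at most
  -- `‖D‖`.
  have hbound : ∀ ε : NNReal, ε ≠ 0 →
      ‖dualForm (fun α => Complex.exp (-(ε * |logPrime α| : ℝ)) • b α) c‖ ≤
        ‖D‖ * ‖ContinuousMap.toLp p haar ℂ (trigPolynomial X c)‖ := by
    intro ε hε
    have hε0 : (0 : ℝ) < ε := by positivity
    obtain ⟨G, hG⟩ := (hardyPlus.translate (⟨ε, hε0⟩ : Set.Ioi (0 : ℝ)) D).2
    have hGn : ‖(G : Lp (StrongDual ℂ X) q haar)‖ ≤ ‖D‖ := by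
      rw [← norm_hardyBohr]
      refine le_trans (le_of_eq (congrArg norm ?_)) (hardyPlus.norm_translate_le D ⟨ε, hε0⟩)
      exact Subtype.ext hG
    have hco := fourierCoeff_eq_of_hardyBohr_eq (ε := ε) hG
    have e : (fun α => Complex.exp (-(ε * |logPrime α| : ℝ)) • b α) =
        fun α => fourierCoeff (G : Lp (StrongDual ℂ X) q haar) (-α) := by
      funext α
      rw [hco, logPrime_neg, abs_neg]
    rw [e, ← pairing_trigPolynomial (p := p)]
    exact (norm_pairing_apply_le _ _).trans (mul_le_mul_of_nonneg_right hGn (norm_nonneg _))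
  let δ : ℕ → NNReal := fun m => 1 / ((m : NNReal) + 1)
  have hδ0 : Filter.Tendsto (fun m => (δ m : ℝ)) Filter.atTop (nhds 0) := by
    simpa [δ] using tendsto_one_div_add_atTop_nhds_zero_nat (𝕜 := ℝ)
  -- Only the finitely many indices in `c.support` occur, so the damping can be removed termwise.
  have hlim : Filter.Tendsto
      (fun m => dualForm (fun α => Complex.exp (-(δ m * |logPrime α| : ℝ)) • b α) c)
      Filter.atTop (nhds (dualForm b c)) := by
    have hc : Continuous fun d : ℝ =>
        ∑ α ∈ c.support, Complex.exp (-(d * |logPrime α| : ℝ)) * b α (c α) := by fun_prop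
    have := (hc.tendsto 0).comp hδ0
    simp only [dualForm_apply, smul_apply, smul_eq_mul]
    simpa [Function.comp_def] using this
  exact le_of_tendsto' hlim.norm fun m => hbound (δ m) (by positivity)

/-! ### Passing between functionals and Dirichlet series -/

variable {E : Type*} [NormedAddCommGroup E] [NormedSpace ℂ E] (ι : C(Torus, X) →L[ℂ] E)

/-- The map which associates to a functional `f` the Dirichlet series with the coefficients
`x ↦ f(ω^{-α} ⊗ x)`. -/
noncomputable def toDirichlet : StrongDual ℂ E →ₗ[ℂ] DirichletSeries (StrongDual ℂ X) :=
  (bohr (StrongDual ℂ X)).toLinearMap ∘ₗ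
    { toFun := fun f α => coeffDual ι f (-toInt α)
      map_add' := fun _ _ => rfl
      map_smul' := fun _ _ => rfl }

theorem toDirichlet_primePow (f : StrongDual ℂ E) (α : ℕ →₀ ℕ) :
    toDirichlet ι f (primePow α) = coeffDual ι f (-toInt α) := by
  rw [toDirichlet, LinearMap.comp_apply, LinearEquiv.coe_coe, bohr_primePow]
  rfl

variable {ι}

theorem dirichletCoeff_toDirichlet {f : StrongDual ℂ E}
    (hf : ∀ α x, (∃ i, α i < 0) → f (ι (tensor (-α) x)) = 0) (α : ℕ →₀ ℤ) :
    dirichletCoeff (toDirichlet ι f) α = coeffDual ι f (-α) := by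
  by_cases hα : ∃ i, α i < 0
  · rw [dirichletCoeff_of_neg _ hα]
    ext x
    exact (hf α x hα).symm
  · obtain ⟨β, rfl⟩ : ∃ β, α = toInt β := ⟨_, eq_toInt_of_nonneg hα⟩
    rw [dirichletCoeff_toInt, toDirichlet_primePow]

theorem exists_hardyTorus_of_functional [q.HolderConjugate p]
    (hn : ∀ h, ‖ι h‖ = ‖ContinuousMap.toLp p haar ℂ h‖) {f : StrongDual ℂ E}
    (hf : ∀ α x, (∃ i, α i < 0) → f (ι (tensor (-α) x)) = 0) (ε : Set.Ioi (0 : ℝ)) :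
    ∃ G : hardyTorus q (StrongDual ℂ X), ‖(G : Lp (StrongDual ℂ X) q haar)‖ ≤ ‖f‖ ∧
      hardyBohr q (StrongDual ℂ X) G = translate ((ε : ℝ) : ℂ) (toDirichlet ι f) := by
  obtain ⟨ε, hε⟩ := ε
  lift ε to NNReal using (Set.mem_Ioi.mp hε).le
  have hε0 : ε ≠ 0 := by
    rintro rfl
    simp at hε
  obtain ⟨G, hG, hco⟩ := exists_Lp_fourierCoeff_eq (q := q) hn f hf hε0
  refine ⟨⟨G, fun α hα => ?_⟩, hG, ?_⟩
  · rw [hco]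
    ext x
    exact (congrArg _ (hf α x hα)).trans (mul_zero _)
  · funext n
    obtain ⟨α, rfl⟩ := primePow_bijective.2 n
    rw [hardyBohr_primePow, hco, ← one_div_primePow_cpow, ← toDirichlet_primePow]
    rfl

theorem toDirichlet_mem_hardyPlus [q.HolderConjugate p]
    (hn : ∀ h, ‖ι h‖ = ‖ContinuousMap.toLp p haar ℂ h‖) {f : StrongDual ℂ E}
    (hf : ∀ α x, (∃ i, α i < 0) → f (ι (tensor (-α) x)) = 0) :
    ∃ h : toDirichlet ι f ∈ hardyPlus q (StrongDual ℂ X),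
      ‖(⟨_, h⟩ : hardyPlus q (StrongDual ℂ X))‖ ≤ ‖f‖ := by
  have key : ∀ ε : Set.Ioi (0 : ℝ), ∃ h : translate ((ε : ℝ) : ℂ) (toDirichlet ι f) ∈
      hardyDirichlet q (StrongDual ℂ X),
      ‖(⟨_, h⟩ : hardyDirichlet q (StrongDual ℂ X))‖ ≤ ‖f‖ := fun ε => by
    obtain ⟨G, hG, he⟩ := exists_hardyTorus_of_functional (q := q) hn hf ε
    refine ⟨⟨G, he⟩, ?_⟩
    rw [← norm_hardyBohr] at hG
    exact le_trans (le_of_eq (congrArg norm (Subtype.ext he.symm))) hG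
  choose h hle using key
  refine ⟨⟨h, ‖f‖, ?_⟩, ?_⟩
  · rintro - ⟨ε, rfl⟩
    exact hle ε
  · exact Real.iSup_le hle (norm_nonneg f)

theorem norm_le_of_toDirichlet_eq [q.HolderConjugate p]
    (hn : ∀ h, ‖ι h‖ = ‖ContinuousMap.toLp p haar ℂ h‖) (hd : DenseRange ι)
    {f : StrongDual ℂ E} (hf : ∀ α x, (∃ i, α i < 0) → f (ι (tensor (-α) x)) = 0)
    {D : hardyPlus q (StrongDual ℂ X)}
    (hD : (D : DirichletSeries (StrongDual ℂ X)) = toDirichlet ι f) : ‖f‖ ≤ ‖D‖ := by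
  refine f.opNorm_le_bound (norm_nonneg D) fun e => ?_
  refine (hd.comp denseRange_trigPolynomial ι.continuous).induction_on e
    (isClosed_le (by fun_prop) (by fun_prop)) fun c => ?_
  have h := norm_dualForm_dirichletCoeff_le (p := p) D c
  simp only [hD, dirichletCoeff_toDirichlet hf, neg_neg] at h
  rw [dualForm_coeffDual, ← hn] at h
  exact h

theorem exists_functional_toDirichlet_eq [q.HolderConjugate p]
    (hn : ∀ h, ‖ι h‖ = ‖ContinuousMap.toLp p haar ℂ h‖) (hd : DenseRange ι)
    (D : hardyPlus q (StrongDual ℂ X)) :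
    ∃ f : StrongDual ℂ E, (∀ α x, (∃ i, α i < 0) → f (ι (tensor (-α) x)) = 0) ∧
      toDirichlet ι f = D := by
  set e : ((ℕ →₀ ℤ) →₀ X) →ₗ[ℂ] E := (ι : C(Torus, X) →ₗ[ℂ] E) ∘ₗ trigPolynomial X with he
  have hde : DenseRange e := hd.comp denseRange_trigPolynomial ι.continuous
  set b : (ℕ →₀ ℤ) → StrongDual ℂ X := fun α =>
    dirichletCoeff (D : DirichletSeries (StrongDual ℂ X)) (-α) with hb
  have hbd : ∀ c, ‖dualForm b c‖ ≤ ‖D‖ * ‖e c‖ := fun c => by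
    refine (norm_dualForm_dirichletCoeff_le (p := p) D c).trans (le_of_eq ?_)
    rw [← hn]
    rfl
  -- The bound `hbd` and the density of the range of `e` let the form descend from coefficient
  -- families to a functional on `E`.
  have hco : ∀ α x, (dualForm b).extendOfNorm e (ι (tensor α x)) = b α x := fun α x => by
    have h := LinearMap.extendOfNorm_eq hde ⟨_, hbd⟩ (Finsupp.single α x)
    rwa [dualForm_single, he, LinearMap.comp_apply, trigPolynomial_single] at h
  refine ⟨(dualForm b).extendOfNorm e, fun α x hα => ?_, ?_⟩
  · rw [hco, hb]
    simp only [neg_neg, dirichletCoeff_of_neg _ hα]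
    rfl
  · funext n
    obtain ⟨α, rfl⟩ := primePow_bijective.2 n
    rw [toDirichlet_primePow]
    ext x
    rw [coeffDual_apply, hco, hb]
    simp only [neg_neg, dirichletCoeff_toInt]

theorem exists_linearIsometryEquiv_hardyPlus (hpq : p⁻¹ + q⁻¹ = 1)
    (hn : ∀ h, ‖ι h‖ = ‖ContinuousMap.toLp p haar ℂ h‖) (hd : DenseRange ι)
    (A : Submodule ℂ (StrongDual ℂ E))
    (hA : ∀ f, f ∈ A ↔ ∀ α x, (∃ i, α i < 0) → f (ι (tensor (-α) x)) = 0) :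
    ∃ Φ : A ≃ₗᵢ[ℂ] hardyPlus q (StrongDual ℂ X), ∀ (f : A) (α : ℕ →₀ ℕ) (x : X),
      (Φ f : DirichletSeries (StrongDual ℂ X)) (primePow α) x =
        (f : StrongDual ℂ E) (ι (tensor (-toInt α) x)) := by
  have hconj : q.HolderConjugate p := ENNReal.holderConjugate_iff.mpr (by rw [add_comm, hpq])
  let T : A →ₗ[ℂ] hardyPlus q (StrongDual ℂ X) :=
    ((toDirichlet ι).domRestrict A).codRestrict (hardyPlus q (StrongDual ℂ X)) fun f =>
      (toDirichlet_mem_hardyPlus hn ((hA f).mp f.2)).1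
  have hT : ∀ f : A, ‖T f‖ = ‖f‖ := fun f =>
    le_antisymm (toDirichlet_mem_hardyPlus (q := q) hn ((hA f).mp f.2)).2
      (norm_le_of_toDirichlet_eq hn hd ((hA f).mp f.2) rfl)
  have hsurj : Function.Surjective T := fun D => by
    obtain ⟨f, hf, hfD⟩ := exists_functional_toDirichlet_eq hn hd D
    exact ⟨⟨f, (hA f).mpr hf⟩, Subtype.ext hfD⟩
  have hinj : Function.Injective T := LinearMap.ker_eq_bot.mp (LinearMap.ker_eq_bot'.mpr fun f hf =>
    Subtype.ext (norm_eq_zero.mp ((hT f).symm.trans ((congrArg norm hf).trans norm_zero))))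
  refine ⟨⟨LinearEquiv.ofBijective T ⟨hinj, hsurj⟩, hT⟩, fun f α x => ?_⟩
  change toDirichlet ι f (primePow α) x = _
  rw [toDirichlet_primePow, coeffDual_apply]

end

end BohrHardy

theorem mainTheorem11 (X : Type*) [NormedAddCommGroup X] [NormedSpace ℂ X] [CompleteSpace X]
    (p q : ℝ≥0∞) [Fact (1 ≤ p)] [Fact (1 ≤ q)] (hpq : p⁻¹ + q⁻¹ = 1) :
    (p ≠ ∞ →
      ∃ Φ : BohrHardy.dualPlusLp p X ≃ₗᵢ[ℂ] BohrHardy.hardyPlus q (StrongDual ℂ X),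
        ∀ (f : BohrHardy.dualPlusLp p X) (α : ℕ →₀ ℕ) (x : X),
          (Φ f : BohrHardy.DirichletSeries (StrongDual ℂ X)) (BohrHardy.primePow α) x =
            (f : StrongDual ℂ (MeasureTheory.Lp X p BohrHardy.haar))
              (BohrHardy.tensorLp p (-BohrHardy.toInt α) x)) ∧
    (p = ∞ →
      ∃ Φ : BohrHardy.dualPlusC X ≃ₗᵢ[ℂ] BohrHardy.hardyPlus q (StrongDual ℂ X),
        ∀ (f : BohrHardy.dualPlusC X) (α : ℕ →₀ ℕ) (x : X),
          (Φ f : BohrHardy.DirichletSeries (StrongDual ℂ X)) (BohrHardy.primePow α) x =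
            (f : StrongDual ℂ C(BohrHardy.Torus, X))
              (BohrHardy.tensor (-BohrHardy.toInt α) x)) := by
  refine ⟨fun hp => ?_, fun hp => ?_⟩
  · have hn : ∀ h : C(BohrHardy.Torus, X), ‖ContinuousMap.toLp p BohrHardy.haar ℂ h‖ =
        ‖ContinuousMap.toLp p BohrHardy.haar ℂ h‖ := fun _ => rfl
    -- Density of continuous functions in `L_p` needs `p ≠ ∞`; for `p = ∞` the space is `C(𝕋^ℕ, X)`
    -- itself and `ι` is the identity.
    have hd : DenseRange (ContinuousMap.toLp (E := X) p BohrHardy.haar ℂ) :=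
      ContinuousMap.toLp_denseRange X BohrHardy.haar ℂ hp
    have hA : ∀ f : StrongDual ℂ (MeasureTheory.Lp X p BohrHardy.haar),
        f ∈ BohrHardy.dualPlusLp p X ↔ ∀ (α : ℕ →₀ ℤ) (x : X), (∃ i, α i < 0) →
          f (ContinuousMap.toLp p BohrHardy.haar ℂ (BohrHardy.tensor (-α) x)) = 0 :=
      fun _ => Iff.rfl
    have h := BohrHardy.exists_linearIsometryEquiv_hardyPlus (p := p) (q := q) hpq hn hd
      (BohrHardy.dualPlusLp p X) hA
    exact h
  · subst hp
    have hn : ∀ h : C(BohrHardy.Torus, X), ‖ContinuousLinearMap.id ℂ C(BohrHardy.Torus, X) h‖ =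
        ‖ContinuousMap.toLp ∞ BohrHardy.haar ℂ h‖ := fun h => (BohrHardy.norm_toLp_top h).symm
    have hd : DenseRange (ContinuousLinearMap.id ℂ C(BohrHardy.Torus, X)) :=
      Function.surjective_id.denseRange
    have hA : ∀ f : StrongDual ℂ C(BohrHardy.Torus, X), f ∈ BohrHardy.dualPlusC X ↔
        ∀ (α : ℕ →₀ ℤ) (x : X), (∃ i, α i < 0) →
          f (ContinuousLinearMap.id ℂ C(BohrHardy.Torus, X) (BohrHardy.tensor (-α) x)) = 0 :=
      fun _ => Iff.rfl
    have h := BohrHardy.exists_linearIsometryEquiv_hardyPlus (p := ∞) (q := q) hpq hn hd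
      (BohrHardy.dualPlusC X) hA
    exact h
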